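/- **Theorem (one-step residual bound for the Anderson accelerated decoupled Picard iteration, steady Boussinesq system).** *Setting.* Let $d\in\{2,3\}$, let $\Omega\subset\mathbb R^d$ be a bounded open set and $\Gamma_1\subseteq\partial\Omega$ the part of the boundary on which the temperature is prescribed ($\Gamma_1=\partial\Omega$ is the pure Dirichlet problem). Let $(\cdot,\cdot)$, $\|\cdot\|$ be the $L^2(\Omega)$ inner product and norm. Let $X=H^1_0(\Omega)^d$, where $H^1_0(\Omega)$ is the $H^1$-closure of $C_c^\infty(\Omega)$, and let $W$ be the closure in $H^1(\Omega)$ of the restrictions to $\Omega$ of the functions of $C_c^\infty(\mathbb R^d)$ whose support does not meet $\overline{\Gamma_1}$ (so $W=H_0^1(\Omega)$ if $\Gamma_1=\partial\Omega$). Put $$b(u,v,w)=\tfrac12\big((u\cdot\nabla v,w)-(u\cdot\nabla w,v)\big)\ \text{ on } X^3,\qquad b^*(u,\phi,\psi)=\tfrac12\big((u\cdot\nabla\phi,\psi)-(u\cdot\nabla\psi,\phi)\big)\ \text{ on } X\times W\times W.$$ Let $\nu,\kappa>0$, $Ri\ge0$, and let $f$, $\gamma$ be bounded linear functionals on $X$,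 $W$, with pairings $(f,v)$, $(\gamma,\chi)$ and dual norms $\|f\|_{-1}=\sup_{v\neq0}|(f,v)|/\|\nabla v\|$, $\|\gamma\|_{-1}=\sup_{\chi\ne0}|(\gamma,\chi)|/\|\nabla\chi\|$. Let $X_h\subset X$, $W_h\subset W$, $Q_h\subset L^2_0(\Omega)$ be finite-dimensional (finite element) spaces, with the functions in $X_h$ bounded, and $V_h=\{v\in X_h:(\nabla\cdot v,q)=0\ \forall q\in Q_h\}$. Put $\|(v,\chi)\|_B=\sqrt{\nu\|\nabla v\|^2+\kappa\|\nabla\chi\|^2}$. *Constants.* Let $C_P>0$ satisfy $\|v\|\le C_P\|\nabla v\|$ for all $v\in X$ and all $v\in W$, and let $M>0$ satisfy $b(u,v,w)\le M\|\nabla u\|\|\nabla v\|\|\nabla w\|$ on $X^3$ and $b^*(u,\phi,\psi)\le M\|\nabla u\|\|\nabla\phi\|\|\nabla\psi\|$ on $X\times W\times W$. Put $\eta=\min\{\nu,\kappa\}$, $K_2=\kappa^{-1}\|\gamma\|_{-1}$, $K_1=Ri\,C_P^2\nu^{-1}\kappa^{-1}\|\gamma\|_{-1}+\nu^{-1}\|f\|_{-1}$,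 $$C_G=\nu^{-1/2}\eta^{-1/2}M\sqrt{2K_1^2+3K_2^2},\qquad \hat C_G=2\nu^{-1}\eta^{-3/2}M^2\sqrt{2K_1^2+9K_2^2}.$$ Assume the small data condition $$\eta^{-2}M\big(2(Ri\,C_P^2\kappa^{-1}\|\gamma\|_{-1}+\|f\|_{-1})+\kappa^{-2}M\|\gamma\|_{-1}^2\big)<1,\qquad \eta^{-1}Ri\,C_P^2<1,$$ and $C_G<1$. *Algorithm.* Let $m\ge0$ be the depth, $m_k=\min\{k-1,m\}$, $\beta_1=1$, and $0<\beta_k\le1$ for $k\ge2$. Let $(u_0,\theta_0)\in X_h\times W_h$. For $k=1,2,\dots$ let $(\tilde u_k,\tilde\theta_k)\in V_h\times W_h$ satisfy, for all $\chi\in W_h$, $v\in V_h$, $$b^*(u_{k-1},\tilde\theta_k,\chi)+\kappa(\nabla\tilde\theta_k,\nabla\chi)=(\gamma,\chi),\qquad b(u_{k-1},\tilde u_k,v)+\nu(\nabla\tilde u_k,\nabla v)=Ri\,(\langle0,\tilde\theta_k\rangle^T,v)+(f,v),$$ where $\langle 0,\theta\rangle^T$ is the vector field with last component $\theta$ and all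 others $0$; put $(w_k,z_k)=(\tilde u_k-u_{k-1},\tilde\theta_k-\theta_{k-1})$; choose real $\{\alpha^k_j\}_{j=k-m_k}^{k-1}$ minimizing $\|(w^\alpha_k,z^\alpha_k)\|_B$, where $$(w^\alpha_k,z^\alpha_k)=\Big(1-\sum_{j=k-m_k}^{k-1}\alpha^k_j\Big)(w_k,z_k)+\sum_{j=k-m_k}^{k-1}\alpha^k_j(w_j,z_j);$$ and set $$(u_k,\theta_k)=\Big(1-\sum_{j=k-m_k}^{k-1}\alpha^k_j\Big)(u_{k-1},\theta_{k-1})+\sum_{j=k-m_k}^{k-1}\alpha^k_j(u_{j-1},\theta_{j-1})+\beta_k(w_k^\alpha,z_k^\alpha).$$ (For $k=1$ this is the plain Picard step.) Let $\xi_k=\|(w_k^\alpha,z_k^\alpha)\|_B/\|(w_k,z_k)\|_B$, read as $0$ if $(w_k,z_k)=0$. *Conclusion.* There is a constant $C=C(m,c_s,C_G)$, depending on nothing else, such that the following holds in every such situation. Let $k\ge1$, $c_s>0$, and put $d_j=(w_{j+1},z_{j+1})-(w_j,z_j)$. Suppose that for every $n\in\{k-m_k,\dots,k\}$ and every $j\in\{n-m_n,\dots,n-1\}$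 the direction sine, in the $B$-inner product, between $d_j$ and $\mathrm{span}\{d_i: n-m_n\le i\le j-1\}$ is at least $c_s$, i.e. $\|d_j-g\|_B\ge c_s\|d_j\|_B$ for all $g$ in this span. Then, with $h(\xi_j)=C\sqrt{1-\xi_j^2}+\beta_j\xi_j$, $$\|(w_{k+1},z_{k+1})\|_B\le\|(w_k,z_k)\|_B\Bigg(\xi_k(1-\beta_k+C_G\beta_k)+\frac{C\hat C_G\sqrt{1-\xi_k^2}}2\bigg(\|(w_k,z_k)\|_Bh(\xi_k)+2\sum_{j=k-m_k+1}^{k-1}(k-j)\|(w_j,z_j)\|_Bh(\xi_j)+m_k\|(w_{k-m_k},z_{k-m_k})\|_Bh(\xi_{k-m_k})\bigg)\Bigg).$$ -/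

import Mathlib

open MeasureTheory
open scoped ContDiff ENNReal

noncomputable section

namespace Boussinesq

/-- Euclidean space of dimension `d`. -/
abbrev E (d : ℕ) := EuclideanSpace ℝ (Fin d)

/-- The space `L²(Ω)`. -/
abbrev L2 {d : ℕ} (Ω : Set (E d)) := Lp ℝ 2 (volume.restrict Ω : Measure (E d))

/-- The pairs `(φ, ∇φ)`, restricted to `Ω`, of smooth compactly supported functions `φ` on `ℝ^d`
whose support stays away from `Γ`. -/
def smoothGraph {d : ℕ} (Ω Γ : Set (E d)) : Set (L2 Ω × (Fin d → L2 Ω)) :=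
  {p | ∃ φ : E d → ℝ, ContDiff ℝ ∞ φ ∧ HasCompactSupport φ ∧ Disjoint (tsupport φ) (closure Γ) ∧
    p.1 =ᵐ[volume.restrict Ω] φ ∧
    ∀ i, p.2 i =ᵐ[volume.restrict Ω] fun x => fderiv ℝ φ x (EuclideanSpace.single i 1)}

/-- The Sobolev space of the functions of `H¹(Ω)` that vanish on the part `Γ` of the boundary:
the closure, in the `H¹` topology, of the smooth functions that vanish near `Γ`.
An element is a pair `(u, ∇u)` of the function and its weak gradient.
For `Γ = ∂Ω` the functions are those of the closure of `C_c^∞(Ω)`, so that this is `H¹₀(Ω)`. -/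
def H1 {d : ℕ} (Ω Γ : Set (E d)) : Submodule ℝ (L2 Ω × (Fin d → L2 Ω)) :=
  (Submodule.span ℝ (smoothGraph Ω Γ)).topologicalClosure

/-- The velocity space `X = H¹₀(Ω)^d`. -/
abbrev Vel {d : ℕ} (Ω : Set (E d)) := Fin d → H1 Ω (frontier Ω)

/-- The temperature space `W` (temperature zero on `Γ`, insulated on the rest of the boundary). -/
abbrev Temp {d : ℕ} (Ω Γ : Set (E d)) := H1 Ω Γ

section spaces

variable {d : ℕ} {Ω Γ Γ' : Set (E d)}

/-- The function `u` of the pair `(u, ∇u)`. -/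
def fn (u : H1 Ω Γ) : L2 Ω := u.1.1

/-- The weak partial derivative `∂ᵢ u`. -/
def pd (u : H1 Ω Γ) (i : Fin d) : L2 Ω := u.1.2 i

/-- `(∇θ, ∇χ)` for scalar functions. -/
def gradInnerT (θ χ : H1 Ω Γ) : ℝ := ∑ i, inner ℝ (pd θ i) (pd χ i)

/-- `(∇u, ∇v)` for vector fields. -/
def gradInnerV (u v : Vel Ω) : ℝ := ∑ j, gradInnerT (u j) (v j)

/-- `‖∇θ‖` for scalar functions. -/
def gradNormT (θ : H1 Ω Γ) : ℝ := √(gradInnerT θ θ)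

/-- `‖∇u‖` for vector fields. -/
def gradNormV (u : Vel Ω) : ℝ := √(gradInnerV u u)

/-- `‖u‖` in `L²(Ω)^d`. -/
def l2NormV (u : Vel Ω) : ℝ := √(∑ j, ‖fn (u j)‖ ^ 2)

/-- The divergence of a vector field. -/
def divergence (u : Vel Ω) : L2 Ω := ∑ i, pd (u i) i

/-- `(u · ∇φ, ψ)` for a vector field `u` and scalar functions `φ`, `ψ`. -/
def convT (u : Vel Ω) (φ ψ : H1 Ω Γ) : ℝ :=
  ∫ x in Ω, (∑ i, fn (u i) x * pd φ i x) * fn ψ x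

/-- `(u · ∇v, w)` for vector fields. -/
def convV (u v w : Vel Ω) : ℝ :=
  ∫ x in Ω, ∑ j, (∑ i, fn (u i) x * pd (v j) i x) * fn (w j) x

/-- The skew-symmetrized trilinear form `b`. -/
def b (u v w : Vel Ω) : ℝ := (convV u v w - convV u w v) / 2

/-- The skew-symmetrized trilinear form `b*`. -/
def bStar (u : Vel Ω) (φ ψ : H1 Ω Γ) : ℝ := (convT u φ ψ - convT u ψ φ) / 2

/-- `(⟨0, θ⟩ᵀ, v)`: the temperature acts on the last component of the vector field. -/
def buoyancy (θ : H1 Ω Γ) (v : Vel Ω) : ℝ :=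
  ∑ i : Fin d, if (i : ℕ) + 1 = d then inner ℝ (fn θ) (fn (v i)) else 0

/-- The norm of `H⁻¹(Ω)^d`, dual to `‖∇v‖`. -/
def dualNormV (f : Vel Ω →L[ℝ] ℝ) : ℝ := sInf {c | 0 ≤ c ∧ ∀ v, |f v| ≤ c * gradNormV v}

/-- The norm of `H⁻¹(Ω)` (the dual of the temperature space), dual to `‖∇χ‖`. -/
def dualNormT (γ : Temp Ω Γ →L[ℝ] ℝ) : ℝ := sInf {c | 0 ≤ c ∧ ∀ χ, |γ χ| ≤ c * gradNormT χ}

end spaces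

/-- The discrete steady Boussinesq problem: the domain, the part `Γ` of its boundary on which the
temperature is prescribed (`Γ = ∂Ω` is the pure Dirichlet problem), the physical parameters, the
forcing terms, and conforming finite element spaces for velocity, pressure and temperature.
Finite element velocities, being piecewise polynomial, are bounded. -/
structure Problem (d : ℕ) where
  Ω : Set (E d)
  isOpen : IsOpen Ω
  isBounded : Bornology.IsBounded Ω
  Γ : Set (E d)
  Γ_subset : Γ ⊆ frontier Ω
  ν : ℝ
  ν_pos : 0 < ν
  κ : ℝ
  κ_pos : 0 < κ
  Ri : ℝ
  Ri_nonneg : 0 ≤ Ri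
  f : Vel Ω →L[ℝ] ℝ
  γ : Temp Ω Γ →L[ℝ] ℝ
  Xh : Submodule ℝ (Vel Ω)
  Xh_finite : FiniteDimensional ℝ Xh
  Xh_bounded : ∀ v ∈ Xh, ∀ j, MemLp (fn (v j)) ∞ (volume.restrict Ω)
  Qh : Submodule ℝ (L2 Ω)
  Qh_finite : FiniteDimensional ℝ Qh
  Qh_mean : ∀ q ∈ Qh, ∫ x in Ω, q x = 0
  Wh : Submodule ℝ (Temp Ω Γ)
  Wh_finite : FiniteDimensional ℝ Wh

namespace Problem

variable {d : ℕ} (P : Problem d)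

/-- Pairs (velocity, temperature). -/
abbrev State := Vel P.Ω × Temp P.Ω P.Γ

/-- The discretely divergence-free velocities `V_h`. -/
def Vh : Set (Vel P.Ω) := {v | v ∈ P.Xh ∧ ∀ q ∈ P.Qh, inner ℝ (divergence v) q = 0}

/-- The `B`-norm `√(ν ‖∇v‖² + κ ‖∇χ‖²)`. -/
def bNorm (y : P.State) : ℝ := √(P.ν * gradNormV y.1 ^ 2 + P.κ * gradNormT y.2 ^ 2)

/-- `C_P` is a constant of the Poincaré inequality on `X` and on `W`. -/
def IsPoincareConstant (CP : ℝ) : Prop :=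
  0 < CP ∧ (∀ v : Vel P.Ω, l2NormV v ≤ CP * gradNormV v) ∧
    ∀ χ : Temp P.Ω P.Γ, ‖fn χ‖ ≤ CP * gradNormT χ

/-- `M` is a bound for the trilinear forms `b` on `X × X × X` and `b*` on `X × W × W`. -/
def IsTrilinearConstant (M : ℝ) : Prop :=
  0 < M ∧ (∀ u v w : Vel P.Ω, b u v w ≤ M * gradNormV u * gradNormV v * gradNormV w) ∧
    ∀ (u : Vel P.Ω) (φ ψ : Temp P.Ω P.Γ),
      bStar u φ ψ ≤ M * gradNormV u * gradNormT φ * gradNormT ψ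

/-- `η = min {ν, κ}`. -/
def η : ℝ := min P.ν P.κ

/-- `K₁ = Ri C_P² ν⁻¹ κ⁻¹ ‖γ‖₋₁ + ν⁻¹ ‖f‖₋₁`. -/
def K₁ (CP : ℝ) : ℝ :=
  P.Ri * CP ^ 2 * P.ν⁻¹ * P.κ⁻¹ * dualNormT P.γ + P.ν⁻¹ * dualNormV P.f

/-- `K₂ = κ⁻¹ ‖γ‖₋₁`. -/
def K₂ : ℝ := P.κ⁻¹ * dualNormT P.γ

/-- The small data condition. -/
def SmallData (CP M : ℝ) : Prop :=
  (P.η ^ 2)⁻¹ * M * (2 * (P.Ri * CP ^ 2 * P.κ⁻¹ * dualNormT P.γ + dualNormV P.f)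
      + (P.κ ^ 2)⁻¹ * M * dualNormT P.γ ^ 2) < 1 ∧
    P.η⁻¹ * P.Ri * CP ^ 2 < 1

/-- The constant `C_G = ν^{-1/2} η^{-1/2} M √(2 K₁² + 3 K₂²)`. -/
def CG (CP M : ℝ) : ℝ :=
  (√P.ν)⁻¹ * (√P.η)⁻¹ * M * √(2 * P.K₁ CP ^ 2 + 3 * P.K₂ ^ 2)

/-- The constant `Ĉ_G = 2 ν⁻¹ η^{-3/2} M² √(2 K₁² + 9 K₂²)`. -/
def CGhat (CP M : ℝ) : ℝ :=
  2 * P.ν⁻¹ * (√P.η ^ 3)⁻¹ * M ^ 2 * √(2 * P.K₁ CP ^ 2 + 9 * P.K₂ ^ 2)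

/-- `y = (ũ, θ̃) ∈ V_h × W_h` is the result of one decoupled Picard step from the velocity `u`,
that is, `y = G(u, θ)` (the previous temperature does not enter). -/
structure IsPicardStep (u : Vel P.Ω) (y : P.State) : Prop where
  mem_velocity : y.1 ∈ P.Vh
  mem_temperature : y.2 ∈ P.Wh
  energy : ∀ χ ∈ P.Wh, bStar u y.2 χ + P.κ * gradInnerT y.2 χ = P.γ χ
  momentum : ∀ v ∈ P.Vh, b u y.1 v + P.ν * gradInnerV y.1 v = P.Ri * buoyancy y.2 v + P.f v

end Problem

/-- The number `m_k = min {k - 1, m}` of earlier residuals that step `k` uses. -/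
def depth (m k : ℕ) : ℕ := min (k - 1) m

/-- `(1 - ∑ a_j) y_k + ∑ a_j y_j`, both sums over `k - m_k ≤ j ≤ k - 1`. -/
def average {V : Type*} [AddCommGroup V] [Module ℝ V] (m k : ℕ) (a : ℕ → ℝ) (y : ℕ → V) : V :=
  (1 - ∑ j ∈ Finset.Ico (k - depth m k) k, a j) • y k +
    ∑ j ∈ Finset.Ico (k - depth m k) k, a j • y j

namespace Problem

variable {d : ℕ} (P : Problem d)

/-- The sequences generated by the Anderson accelerated Picard iteration of depth `m` with damping
factors `β`: the iterates `x k = (u_k, θ_k)`, the Picard updates `xt k = (ũ_k, θ̃_k)`, the residuals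
`w k = (w_k, z_k)` and the optimization coefficients `α k j`.
The first step has `m_1 = 0`, so that with `β 1 = 1` it is the plain Picard step. -/
structure IsAndersonRun (m : ℕ) (β : ℕ → ℝ) (x xt w : ℕ → P.State) (α : ℕ → ℕ → ℝ) : Prop where
  init_velocity : (x 0).1 ∈ P.Xh
  init_temperature : (x 0).2 ∈ P.Wh
  damping_first : β 1 = 1
  damping : ∀ k, 2 ≤ k → 0 < β k ∧ β k ≤ 1
  picard : ∀ k, 1 ≤ k → P.IsPicardStep (x (k - 1)).1 (xt k)
  residual : ∀ k, 1 ≤ k → w k = xt k - x (k - 1)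
  optimal : ∀ k, 1 ≤ k → ∀ a : ℕ → ℝ,
    P.bNorm (average m k (α k) w) ≤ P.bNorm (average m k a w)
  update : ∀ k, 1 ≤ k →
    x k = average m k (α k) (fun j => x (j - 1)) + β k • average m k (α k) w

/-- The optimization gain `ξ_k = ‖(w_k^α, z_k^α)‖_B / ‖(w_k, z_k)‖_B`. -/
def gain (m : ℕ) (w : ℕ → P.State) (α : ℕ → ℕ → ℝ) (k : ℕ) : ℝ :=
  P.bNorm (average m k (α k) w) / P.bNorm (w k)

/-- The sine of the angle between `y` and the subspace `S`, that is, the distance from `y` to `S`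
divided by the length of `y`, is at least `c` (in the `B`-norm). -/
def SineGE (c : ℝ) (y : P.State) (S : Submodule ℝ P.State) : Prop :=
  ∀ g ∈ S, c * P.bNorm y ≤ P.bNorm (y - g)

/-- In each of the optimization problems of the steps `n = k - m_k, …, k`, whose matrix has the
columns `w_{j+1} - w_j`, `n - m_n ≤ j ≤ n - 1`, the sine of the angle between each column and the
span of the earlier ones (those of smaller index) is at least `c`. -/
def DirectionSinesGE (c : ℝ) (m : ℕ) (w : ℕ → P.State) (k : ℕ) : Prop :=
  ∀ n ∈ Finset.Icc (k - depth m k) k, ∀ j ∈ Finset.Ico (n - depth m n) n,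
    P.SineGE c (w (j + 1) - w j)
      (Submodule.span ℝ ((fun i => w (i + 1) - w i) '' Set.Ico (n - depth m n) j))

end Problem

/-- The function `h` of the higher order terms, `C √(1 - ξ²) + β ξ`. -/
def hTerm (C β ξ : ℝ) : ℝ := C * √(1 - ξ ^ 2) + β * ξ

end Boussinesq

end

/-! Write `G` for the Picard map, `x̃ j = G(x (j-1))`, `s i = x i - x (i-1)`, `d i = w (i+1) - w i`.
Summation by parts turns an Anderson average into `y k - ∑ γ i (y (i+1) - y i)`. The update formula
then reads `s k + ∑ γ i s i = β k w^α`, and the new residual is `(1 - β k) w^α` plus the combination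
`(x̃ (k+1) - x̃ k) + ∑ γ i (x̃ (i+1) - x̃ i)`, which has the same coefficients `γ i` and `1`.

The central estimate, `bNorm_combination_le`, treats such a combination as one object. Subtract the
equations and test with the combination itself: skew symmetry removes the convection by a fixed
velocity. What remains is `C_G` times the same combination of the arguments, here `C_G β k ‖w^α‖`,
plus quadratic terms `|γ i| ‖s i‖` times distances between iterates, with the factor `Ĉ_G / 2`.
Bounding each difference by the Lipschitz constant alone would lose the cancellation in the
first-order part.

The quadratic terms are controlled by three facts. Since `C_G < 1`, the identity `s i = (x̃ (i+1) -
x̃ i) - d i` gives `‖s i‖ ≤ ‖d i‖ / (1 - C_G)`. The sine condition bounds each `|γ i| ‖d i‖` by a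
multiple of `‖∑ γ i d i‖` (`abs_mul_norm_le_of_sines`). Optimality and Pythagoras give `‖∑ γ i d i‖
= √(1 - ξ²) ‖w‖` (`bNorm_sum_eq`). Applied to earlier steps, the same facts bound `‖s n‖` by `‖w n‖
h(ξ n)`, and distances between iterates telescope into sums of these. -/

noncomputable section

namespace Boussinesq

/-! ### Gradient seminorms, dual norms and the buoyancy term -/

section spaces

variable {d : ℕ} {Ω Γ : Set (E d)}

/-- The gradient of a scalar function, as an element of the Hilbert space `L²(Ω)^d`. -/
def gradT : H1 Ω Γ →ₗ[ℝ] PiLp 2 (fun _ : Fin d => L2 Ω) where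
  toFun u := WithLp.toLp 2 (pd u)
  map_add' _ _ := rfl
  map_smul' _ _ := rfl

/-- The gradient of a vector field, as an element of the Hilbert space `L²(Ω)^{d × d}`. -/
def gradV : Vel Ω →ₗ[ℝ] PiLp 2 (fun _ : Fin d => PiLp 2 (fun _ : Fin d => L2 Ω)) where
  toFun u := WithLp.toLp 2 fun j => gradT (u j)
  map_add' _ _ := rfl
  map_smul' _ _ := rfl

theorem gradInnerT_eq (u v : H1 Ω Γ) : gradInnerT u v = inner ℝ (gradT u) (gradT v) := by
  rw [gradInnerT, PiLp.inner_apply]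
  rfl

theorem gradInnerV_eq (u v : Vel Ω) : gradInnerV u v = inner ℝ (gradV u) (gradV v) := by
  rw [gradInnerV, PiLp.inner_apply]
  exact Finset.sum_congr rfl fun j _ => gradInnerT_eq _ _

theorem gradNormT_eq (u : H1 Ω Γ) : gradNormT u = ‖gradT u‖ := by
  rw [gradNormT, gradInnerT_eq, norm_eq_sqrt_real_inner]

theorem gradNormV_eq (u : Vel Ω) : gradNormV u = ‖gradV u‖ := by
  rw [gradNormV, gradInnerV_eq, norm_eq_sqrt_real_inner]

theorem norm_pd_le (u : H1 Ω Γ) (i : Fin d) : ‖pd u i‖ ≤ gradNormT u := by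
  rw [gradNormT_eq]
  exact PiLp.norm_apply_le (gradT u) i

theorem gradNormT_apply_le (u : Vel Ω) (j : Fin d) : gradNormT (u j) ≤ gradNormV u := by
  rw [gradNormT_eq, gradNormV_eq]
  exact PiLp.norm_apply_le (gradV u) j

theorem norm_fn_le (u : Vel Ω) (j : Fin d) : ‖fn (u j)‖ ≤ l2NormV u := by
  refine Real.le_sqrt_of_sq_le ?_
  exact Finset.single_le_sum (f := fun j => ‖fn (u j)‖ ^ 2) (fun _ _ => sq_nonneg _)
    (Finset.mem_univ j)

/-- Poincaré makes functionals continuous in the graph norm bounded in the gradient seminorm as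
well, so the set defining the dual norm is nonempty and its infimum is not a default value. -/
theorem norm_le_of_poincare_temp {CP : ℝ} (hCP : 0 < CP) {χ : H1 Ω Γ}
    (h : ‖fn χ‖ ≤ CP * gradNormT χ) : ‖χ‖ ≤ (CP + 1) * gradNormT χ := by
  have h0 : 0 ≤ gradNormT χ := Real.sqrt_nonneg _
  have : ‖χ‖ = max ‖fn χ‖ ‖pd χ‖ := rfl
  rw [this]
  refine max_le (by nlinarith) ((pi_norm_le_iff_of_nonneg (by positivity)).2 fun i => ?_)
  have := norm_pd_le χ i
  nlinarith

theorem norm_le_of_poincare_vel {CP : ℝ} (hCP : 0 < CP) {v : Vel Ω}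
    (h : l2NormV v ≤ CP * gradNormV v) : ‖v‖ ≤ (CP + 1) * gradNormV v := by
  have h0 : 0 ≤ gradNormV v := Real.sqrt_nonneg _
  refine (pi_norm_le_iff_of_nonneg (by positivity)).2 fun j => ?_
  have hj : ‖v j‖ = max ‖fn (v j)‖ ‖pd (v j)‖ := rfl
  rw [hj]
  refine max_le ?_ ((pi_norm_le_iff_of_nonneg (by positivity)).2 fun i => ?_)
  · have := norm_fn_le v j
    nlinarith
  · have := norm_pd_le (v j) i
    have := gradNormT_apply_le v j
    nlinarith

/-- The infimum of the constants in a bound of a functional by a seminorm is such a constant. -/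
theorem abs_le_sInf_mul {V : Type*} {g φ : V → ℝ} (hg : ∀ v, 0 ≤ g v)
    (hne : ∃ c, 0 ≤ c ∧ ∀ v, |φ v| ≤ c * g v) (v : V) :
    |φ v| ≤ sInf {c | 0 ≤ c ∧ ∀ v, |φ v| ≤ c * g v} * g v := by
  rcases (hg v).eq_or_lt with h | h
  -- Where the seminorm vanishes one cannot divide, but any admissible constant already forces `φ v
  -- = 0`.
  · obtain ⟨c, -, hc⟩ := hne
    simpa [← h] using hc v
  · rw [← div_le_iff₀ h]
    exact le_csInf hne fun c hc => (div_le_iff₀ h).2 (hc.2 v)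

theorem dualNormV_nonneg (f : Vel Ω →L[ℝ] ℝ) : 0 ≤ dualNormV f :=
  Real.sInf_nonneg fun _ h => h.1

theorem dualNormT_nonneg (γ : Temp Ω Γ →L[ℝ] ℝ) : 0 ≤ dualNormT γ :=
  Real.sInf_nonneg fun _ h => h.1

theorem abs_le_dualNormV {CP : ℝ} (hCP : 0 < CP)
    (h : ∀ v : Vel Ω, l2NormV v ≤ CP * gradNormV v) (f : Vel Ω →L[ℝ] ℝ) (v : Vel Ω) :
    |f v| ≤ dualNormV f * ‖gradV v‖ := by
  rw [← gradNormV_eq]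
  refine abs_le_sInf_mul (fun _ => Real.sqrt_nonneg _) ⟨‖f‖ * (CP + 1), by positivity,
    fun v => ?_⟩ v
  rw [mul_assoc]
  exact (f.le_opNorm v).trans
    (mul_le_mul_of_nonneg_left (norm_le_of_poincare_vel hCP (h v)) (norm_nonneg _))

theorem abs_le_dualNormT {CP : ℝ} (hCP : 0 < CP)
    (h : ∀ χ : Temp Ω Γ, ‖fn χ‖ ≤ CP * gradNormT χ) (γ : Temp Ω Γ →L[ℝ] ℝ) (χ : Temp Ω Γ) :
    |γ χ| ≤ dualNormT γ * ‖gradT χ‖ := by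
  rw [← gradNormT_eq]
  refine abs_le_sInf_mul (fun _ => Real.sqrt_nonneg _) ⟨‖γ‖ * (CP + 1), by positivity,
    fun χ => ?_⟩ χ
  rw [mul_assoc]
  exact (γ.le_opNorm χ).trans
    (mul_le_mul_of_nonneg_left (norm_le_of_poincare_temp hCP (h χ)) (norm_nonneg _))

theorem abs_buoyancy_le (θ : H1 Ω Γ) (v : Vel Ω) : |buoyancy θ v| ≤ ‖fn θ‖ * l2NormV v := by
  cases d with
  | zero =>
    rw [buoyancy, Finset.univ_eq_empty, Finset.sum_empty, abs_zero]
    exact mul_nonneg (norm_nonneg _) (Real.sqrt_nonneg _)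
  | succ n =>
    have : buoyancy θ v = inner ℝ (fn θ) (fn (v (Fin.last n))) := by
      rw [buoyancy, Fin.sum_univ_castSucc]
      have h (i : Fin n) : ¬ ((i.castSucc : Fin (n + 1)) : ℕ) + 1 = n + 1 := by
        have := i.2
        simp only [Fin.val_castSucc]
        omega
      simp only [h, if_false, Finset.sum_const_zero, zero_add, Fin.val_last, if_true]
    rw [this]
    exact (abs_real_inner_le_norm _ _).trans
      (mul_le_mul_of_nonneg_left (norm_fn_le v _) (norm_nonneg _))

/-- The buoyancy form is linear in the temperature. -/
def buoyancyL (v : Vel Ω) : H1 Ω Γ →ₗ[ℝ] ℝ where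
  toFun θ := buoyancy θ v
  map_add' θ θ' := by
    have h : fn (θ + θ') = fn θ + fn θ' := rfl
    simp only [buoyancy, h, inner_add_left, ← Finset.sum_add_distrib]
    exact Finset.sum_congr rfl fun i _ => by split_ifs <;> simp
  map_smul' c θ := by
    have h : fn (c • θ) = c • fn θ := rfl
    simp only [buoyancy, h, real_inner_smul_left, RingHom.id_apply, smul_eq_mul, Finset.mul_sum]
    exact Finset.sum_congr rfl fun i _ => by split_ifs <;> simp

/-! ### Trilinearity of the convection forms for bounded velocities -/

/-- A product of three functions, one essentially bounded and two square integrable, is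
integrable. -/
theorem integrable_mul_mul {X : Type*} [MeasurableSpace X] {μ : Measure X} {f g h : X → ℝ}
    (hf : MemLp f ∞ μ) (hg : MemLp g 2 μ) (hh : MemLp h 2 μ) :
    Integrable (fun x => f x * g x * h x) μ :=
  MemLp.integrable_mul (p := 2) (q := 2) (hg.mul (r := 2) hf) hh

/-- Vector fields with essentially bounded components. -/
def IsBoundedVel (u : Vel Ω) : Prop := ∀ j, MemLp (fn (u j)) ∞ (volume.restrict Ω)

theorem IsBoundedVel.integrable {u : Vel Ω} (hu : IsBoundedVel u) (i : Fin d) (g h : L2 Ω) :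
    Integrable (fun x => fn (u i) x * g x * h x) (volume.restrict Ω) :=
  integrable_mul_mul (hu i) (Lp.memLp g) (Lp.memLp h)

theorem IsBoundedVel.integrable_conv {u : Vel Ω} (hu : IsBoundedVel u) (φ ψ : H1 Ω Γ) :
    Integrable (fun x => (∑ i, fn (u i) x * pd φ i x) * fn ψ x) (volume.restrict Ω) := by
  simp only [Finset.sum_mul]
  exact integrable_finsetSum _ fun i _ => hu.integrable i _ _

/-- Additivity needs integrability of both integrands, since a nonintegrable function has Bochner
integral zero; boundedness of the velocities supplies it. Homogeneity needs no such condition. -/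
theorem convT_add_left {u u' : Vel Ω} (hu : IsBoundedVel u) (hu' : IsBoundedVel u')
    (φ ψ : H1 Ω Γ) : convT (u + u') φ ψ = convT u φ ψ + convT u' φ ψ := by
  rw [convT, convT, convT, ← integral_add (hu.integrable_conv φ ψ) (hu'.integrable_conv φ ψ)]
  refine integral_congr_ae ?_
  have h : ∀ᵐ x ∂(volume.restrict Ω), ∀ i, fn ((u + u') i) x = fn (u i) x + fn (u' i) x :=
    ae_all_iff.2 fun i => Lp.coeFn_add (fn (u i)) (fn (u' i))
  filter_upwards [h] with x hx
  simp only [hx, add_mul, Finset.sum_add_distrib]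

theorem convT_smul_left (c : ℝ) (u : Vel Ω) (φ ψ : H1 Ω Γ) :
    convT (c • u) φ ψ = c * convT u φ ψ := by
  rw [convT, convT, ← integral_const_mul]
  refine integral_congr_ae ?_
  have h : ∀ᵐ x ∂(volume.restrict Ω), ∀ i, fn ((c • u) i) x = c * fn (u i) x :=
    ae_all_iff.2 fun i => Lp.coeFn_smul c (fn (u i))
  filter_upwards [h] with x hx
  simp only [hx, mul_assoc, ← Finset.mul_sum]

theorem convT_add_middle {u : Vel Ω} (hu : IsBoundedVel u) (φ φ' ψ : H1 Ω Γ) :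
    convT u (φ + φ') ψ = convT u φ ψ + convT u φ' ψ := by
  rw [convT, convT, convT, ← integral_add (hu.integrable_conv φ ψ) (hu.integrable_conv φ' ψ)]
  refine integral_congr_ae ?_
  have h : ∀ᵐ x ∂(volume.restrict Ω), ∀ i, pd (φ + φ') i x = pd φ i x + pd φ' i x :=
    ae_all_iff.2 fun i => Lp.coeFn_add (pd φ i) (pd φ' i)
  filter_upwards [h] with x hx
  simp only [hx, add_mul, mul_add, Finset.sum_add_distrib]

theorem convT_smul_middle (c : ℝ) (u : Vel Ω) (φ ψ : H1 Ω Γ) :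
    convT u (c • φ) ψ = c * convT u φ ψ := by
  rw [convT, convT, ← integral_const_mul]
  refine integral_congr_ae ?_
  have h : ∀ᵐ x ∂(volume.restrict Ω), ∀ i, pd (c • φ) i x = c * pd φ i x :=
    ae_all_iff.2 fun i => Lp.coeFn_smul c (pd φ i)
  filter_upwards [h] with x hx
  simp only [hx, mul_left_comm _ c, ← Finset.mul_sum, mul_assoc]

theorem convT_add_right {u : Vel Ω} (hu : IsBoundedVel u) (φ ψ ψ' : H1 Ω Γ) :
    convT u φ (ψ + ψ') = convT u φ ψ + convT u φ ψ' := by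
  rw [convT, convT, convT, ← integral_add (hu.integrable_conv φ ψ) (hu.integrable_conv φ ψ')]
  refine integral_congr_ae ?_
  have h : fn (ψ + ψ') =ᵐ[volume.restrict Ω] fn ψ + fn ψ' := Lp.coeFn_add (fn ψ) (fn ψ')
  filter_upwards [h] with x hx
  simp only [hx, Pi.add_apply, mul_add]

theorem convT_smul_right (c : ℝ) (u : Vel Ω) (φ ψ : H1 Ω Γ) :
    convT u φ (c • ψ) = c * convT u φ ψ := by
  rw [convT, convT, ← integral_const_mul]
  refine integral_congr_ae ?_
  have h : fn (c • ψ) =ᵐ[volume.restrict Ω] c • ⇑(fn ψ) := Lp.coeFn_smul c (fn ψ)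
  filter_upwards [h] with x hx
  simp only [hx, Pi.smul_apply, smul_eq_mul, mul_left_comm _ c]

/-- Reduces the vector form to the scalar one componentwise, so that linearity is checked only for
`bStar`. -/
theorem IsBoundedVel.b_eq {u : Vel Ω} (hu : IsBoundedVel u) (v w : Vel Ω) :
    b u v w = ∑ j, bStar u (v j) (w j) := by
  have h (v w : Vel Ω) : convV u v w = ∑ j, convT u (v j) (w j) :=
    integral_finsetSum _ fun j _ => hu.integrable_conv (v j) (w j)
  simp only [b, bStar, h, ← Finset.sum_sub_distrib, Finset.sum_div]

theorem bStar_swap (u : Vel Ω) (φ ψ : H1 Ω Γ) : bStar u ψ φ = -bStar u φ ψ := by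
  simp only [bStar]; ring

theorem b_swap (u v w : Vel Ω) : b u w v = -b u v w := by
  simp only [b]; ring

/-- The form `b*` as a trilinear map on a space of essentially bounded velocities. -/
def bStarL (X : Submodule ℝ (Vel Ω)) (hX : ∀ u ∈ X, IsBoundedVel u) :
    X →ₗ[ℝ] H1 Ω Γ →ₗ[ℝ] H1 Ω Γ →ₗ[ℝ] ℝ where
  toFun u := LinearMap.mk₂ ℝ (bStar (u : Vel Ω))
    (fun φ φ' ψ => by
      simp only [bStar, convT_add_middle (hX u u.2), convT_add_right (hX u u.2)]; ring)
    (fun c φ ψ => by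
      simp only [bStar, convT_smul_middle, convT_smul_right, smul_eq_mul]; ring)
    (fun φ ψ ψ' => by
      simp only [bStar, convT_add_middle (hX u u.2), convT_add_right (hX u u.2)]; ring)
    (fun c φ ψ => by
      simp only [bStar, convT_smul_middle, convT_smul_right, smul_eq_mul]; ring)
  map_add' u u' := by
    ext φ ψ
    simp only [LinearMap.mk₂_apply, LinearMap.add_apply, bStar, Submodule.coe_add,
      convT_add_left (hX u u.2) (hX u' u'.2)]
    ring
  map_smul' c u := by
    ext φ ψ
    simp only [LinearMap.mk₂_apply, LinearMap.smul_apply, bStar, Submodule.coe_smul,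
      convT_smul_left, RingHom.id_apply, smul_eq_mul]
    ring

theorem bStarL_apply (X : Submodule ℝ (Vel Ω)) (hX : ∀ u ∈ X, IsBoundedVel u) (u : X)
    (φ ψ : H1 Ω Γ) : bStarL X hX u φ ψ = bStar (u : Vel Ω) φ ψ := rfl

/-- The form `b` as a trilinear map on a space of essentially bounded velocities. -/
def bL (X : Submodule ℝ (Vel Ω)) (hX : ∀ u ∈ X, IsBoundedVel u) :
    X →ₗ[ℝ] Vel Ω →ₗ[ℝ] Vel Ω →ₗ[ℝ] ℝ where
  toFun u := LinearMap.mk₂ ℝ (fun v w => ∑ j, bStarL X hX u (v j) (w j))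
    (fun v v' w => by simp [Finset.sum_add_distrib])
    (fun c v w => by simp [Finset.mul_sum])
    (fun v w w' => by simp [Finset.sum_add_distrib])
    (fun c v w => by simp [Finset.mul_sum])
  map_add' u u' := by
    refine LinearMap.ext₂ fun v w => ?_
    simp [Finset.sum_add_distrib]
  map_smul' c u := by
    refine LinearMap.ext₂ fun v w => ?_
    simp [Finset.mul_sum]

theorem bL_apply (X : Submodule ℝ (Vel Ω)) (hX : ∀ u ∈ X, IsBoundedVel u) (u : X)
    (v w : Vel Ω) : bL X hX u v w = b (u : Vel Ω) v w :=
  ((hX u u.2).b_eq v w).symm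

end spaces

/-! ### Energy estimates for skew-symmetric convection -/

section abstract_estimates

variable {U Y H : Type*} [AddCommGroup U] [Module ℝ U] [AddCommGroup Y] [Module ℝ Y]
  [NormedAddCommGroup H] [InnerProductSpace ℝ H]

/-- Energy estimate for a linear equation with a skew-symmetric convection term. -/
theorem energy_bound {c : Y →ₗ[ℝ] Y →ₗ[ℝ] ℝ} {g : Y →ₗ[ℝ] H} {μ R : ℝ} {y : Y}
    (hskew : c y y = 0) (hR : 0 ≤ R)
    (heq : c y y + μ * inner ℝ (g y) (g y) ≤ R * ‖g y‖) : μ * ‖g y‖ ≤ R := by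
  rw [hskew, zero_add, real_inner_self_eq_norm_sq] at heq
  rcases (norm_nonneg (g y)).eq_or_lt with h | h
  · rw [← h]; simpa using hR
  · nlinarith

/-- Stability of linear combinations of differences of solutions `y' i`, `y i` of convection
diffusion equations with the convection velocities `u' i`, `u i`. The first term on the right is of
first order in the differences of velocities, and the sum is of second order. -/
theorem energy_bound_sum {ι : Type*} {c : U →ₗ[ℝ] Y →ₗ[ℝ] Y →ₗ[ℝ] ℝ} {g : Y →ₗ[ℝ] H}
    {p : U → ℝ} {μ M R : ℝ} {S : Submodule ℝ Y} (hskew : ∀ u y, c u y y = 0)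
    (hp : ∀ u, 0 ≤ p u) (hM : 0 ≤ M)
    (hc : ∀ u y z, |c u y z| ≤ M * p u * ‖g y‖ * ‖g z‖)
    (s : Finset ι) (a : ι → ℝ) (u u' : ι → U) (y y' : ι → Y) (l l' : ι → Y → ℝ)
    (hy : ∀ i ∈ s, y i ∈ S) (hy' : ∀ i ∈ s, y' i ∈ S)
    (heq : ∀ i ∈ s, ∀ z ∈ S, c (u i) (y i) z + μ * inner ℝ (g (y i)) (g z) = l i z)
    (heq' : ∀ i ∈ s, ∀ z ∈ S, c (u' i) (y' i) z + μ * inner ℝ (g (y' i)) (g z) = l' i z)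
    (hR : 0 ≤ R) (hl : ∀ z, ∑ i ∈ s, a i * (l' i z - l i z) ≤ R * ‖g z‖)
    (U₀ : U) (y₀ : Y) :
    μ * ‖g (∑ i ∈ s, a i • (y' i - y i))‖ ≤
      M * p (∑ i ∈ s, a i • (u' i - u i)) * ‖g y₀‖ +
      ∑ i ∈ s, |a i| * (M * (p (u' i - u i) * ‖g (y₀ - y i)‖ +
        p (u' i - U₀) * ‖g (y' i - y i)‖)) + R := by
  set D := ∑ i ∈ s, a i • (y' i - y i) with hD
  have hDS : D ∈ S := S.sum_mem fun i hi => S.smul_mem _ (S.sub_mem (hy' i hi) (hy i hi))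
  have hN := norm_nonneg (g D)
  -- For each `i`, `c(u',y') - c(u,y) = c(u'-u, y₀) - c(u'-u, y₀-y) + c(u'-U₀, y'-y) + c(U₀, y'-y)`.
  -- The first term sums to the first-order contribution, the two middle ones are quadratic, and the
  -- last sums to `c U₀ D D`, which vanishes.
  have key : c U₀ D D + μ * inner ℝ (g D) (g D) =
      -c (∑ i ∈ s, a i • (u' i - u i)) y₀ D +
      ∑ i ∈ s, a i * (c (u' i - u i) (y₀ - y i) D - c (u' i - U₀) (y' i - y i) D) +
      ∑ i ∈ s, a i * (l' i D - l i D) := by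
    have h1 : ∑ i ∈ s, a i * (l' i D - l i D) = ∑ i ∈ s, a i *
        (c (u' i) (y' i) D + μ * inner ℝ (g (y' i)) (g D) -
          (c (u i) (y i) D + μ * inner ℝ (g (y i)) (g D))) :=
      Finset.sum_congr rfl fun i hi => by rw [heq i hi D hDS, heq' i hi D hDS]
    have h2 : ∀ z, c U₀ D z = ∑ i ∈ s, a i * c U₀ (y' i - y i) z := fun z => by
      rw [hD]; simp only [map_sum, map_smul, LinearMap.sum_apply, LinearMap.smul_apply, smul_eq_mul]
    have h3 : ∀ z, inner ℝ (g D) z = ∑ i ∈ s, a i * inner ℝ (g (y' i - y i)) z := fun z => by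
      rw [hD]; simp only [map_sum, map_smul, sum_inner, real_inner_smul_left]
    rw [h1, h2, h3]
    simp only [map_sum, map_smul, LinearMap.sum_apply, LinearMap.smul_apply, smul_eq_mul]
    rw [Finset.mul_sum, ← Finset.sum_add_distrib, ← Finset.sum_neg_distrib,
      ← Finset.sum_add_distrib, ← Finset.sum_add_distrib]
    refine Finset.sum_congr rfl fun i _ => ?_
    simp only [map_sub, LinearMap.sub_apply, inner_sub_left]
    ring
  refine energy_bound (c := c U₀) (hskew U₀ D) ?_ ?_
  · refine add_nonneg (add_nonneg (mul_nonneg (mul_nonneg hM (hp _)) (norm_nonneg _)) ?_) hR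
    exact Finset.sum_nonneg fun i _ => mul_nonneg (abs_nonneg _) (mul_nonneg hM
      (add_nonneg (mul_nonneg (hp _) (norm_nonneg _)) (mul_nonneg (hp _) (norm_nonneg _))))
  · rw [key, add_mul, add_mul, Finset.sum_mul]
    refine add_le_add (add_le_add ((neg_le_abs _).trans (hc _ _ _)) ?_) (hl D)
    refine Finset.sum_le_sum fun i _ => ?_
    refine (le_abs_self _).trans ?_
    rw [abs_mul, mul_assoc]
    refine mul_le_mul_of_nonneg_left ?_ (abs_nonneg _)
    refine (abs_sub _ _).trans ?_
    have h1 := hc (u' i - u i) (y₀ - y i) D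
    have h2 := hc (u' i - U₀) (y' i - y i) D
    linarith

end abstract_estimates

/-! ### Anderson averages, optimality and direction sines -/

section anderson

variable {V : Type*} [AddCommGroup V] [Module ℝ V]

/-- The coefficients of an average in terms of the successive differences. -/
def diffCoeff (m k : ℕ) (a : ℕ → ℝ) (i : ℕ) : ℝ := ∑ n ∈ Finset.Ico (k - depth m k) (i + 1), a n

theorem average_eq_sub (m k : ℕ) (a : ℕ → ℝ) (y : ℕ → V) :
    average m k a y = y k - ∑ j ∈ Finset.Ico (k - depth m k) k, a j • (y k - y j) := by
  simp only [average, smul_sub, Finset.sum_sub_distrib, sub_smul, one_smul, Finset.sum_smul]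
  abel

/-- Summation by parts: the difference `y (i+1) - y i` occurs in `y k - y j` exactly when `j ≤ i`,
hence the partial sums up to `i + 1` exclusive. -/
theorem sum_smul_sub_eq (p k : ℕ) (a : ℕ → ℝ) (y : ℕ → V) :
    ∑ j ∈ Finset.Ico p k, a j • (y k - y j) =
      ∑ i ∈ Finset.Ico p k, (∑ n ∈ Finset.Ico p (i + 1), a n) • (y (i + 1) - y i) := by
  rcases le_or_gt p k with hpk | hpk
  · induction k, hpk using Nat.le_induction with
    | base => simp
    | succ k hk ih =>
      rw [Finset.sum_Ico_succ_top hk, Finset.sum_Ico_succ_top hk, ← ih,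
        Finset.sum_Ico_succ_top hk a, add_smul, Finset.sum_smul, ← add_assoc,
        ← Finset.sum_add_distrib]
      congr 1
      exact Finset.sum_congr rfl fun j _ => by rw [← smul_add]; congr 1; abel
  · simp [Finset.Ico_eq_empty_of_le hpk.le]

theorem average_eq (m k : ℕ) (a : ℕ → ℝ) (y : ℕ → V) :
    average m k a y = y k -
      ∑ i ∈ Finset.Ico (k - depth m k) k, diffCoeff m k a i • (y (i + 1) - y i) := by
  rw [average_eq_sub, sum_smul_sub_eq]
  rfl

theorem diffCoeff_mul (m k : ℕ) (t : ℝ) (a : ℕ → ℝ) (i : ℕ) :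
    diffCoeff m k (fun j => t * a j) i = t * diffCoeff m k a i := by
  simp [diffCoeff, Finset.mul_sum]

variable {H : Type*} [NormedAddCommGroup H] [InnerProductSpace ℝ H]

/-- Pythagoras' theorem for the best approximation of `v` by multiples of `c`. -/
theorem norm_sq_of_isMin {v c : H} (h : ∀ t : ℝ, ‖v - c‖ ≤ ‖v - t • c‖) :
    ‖c‖ ^ 2 = ‖v‖ ^ 2 - ‖v - c‖ ^ 2 := by
  rcases eq_or_ne c 0 with rfl | hc
  · simp
  have hn : 0 < ‖c‖ ^ 2 := by positivity
  -- The competitor is the orthogonal projection of `v` on the line of `c`; minimality at `t = 1`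
  -- forces `⟨v, c⟩ = ‖c‖²`.
  have h1 := pow_le_pow_left₀ (norm_nonneg _) (h (inner ℝ v c / ‖c‖ ^ 2)) 2
  rw [norm_sub_sq_real, norm_sub_sq_real, inner_smul_right, norm_smul, mul_pow,
    Real.norm_eq_abs, sq_abs] at h1
  have h2 : inner ℝ v c = ‖c‖ ^ 2 := by
    have h3 : (inner ℝ v c - ‖c‖ ^ 2) ^ 2 / ‖c‖ ^ 2 ≤ 0 := by
      have : (inner ℝ v c - ‖c‖ ^ 2) ^ 2 / ‖c‖ ^ 2 =
          ‖c‖ ^ 2 - 2 * inner ℝ v c + (2 * (inner ℝ v c / ‖c‖ ^ 2 * inner ℝ v c) -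
            (inner ℝ v c / ‖c‖ ^ 2) ^ 2 * ‖c‖ ^ 2) := by
        field_simp; ring
      linarith
    have h4 : (inner ℝ v c - ‖c‖ ^ 2) ^ 2 ≤ 0 := by
      rwa [div_le_iff₀ hn, zero_mul] at h3
    have h5 := pow_eq_zero_iff two_ne_zero |>.1 (le_antisymm h4 (sq_nonneg _))
    linarith
  rw [norm_sub_sq_real, h2]; ring

/-- A lower bound for the direction sines of a family of vectors makes each term of a linear
combination controlled by the whole. -/
theorem abs_mul_norm_le_of_sines {cs : ℝ} (hcs : 0 < cs) (p : ℕ) (g : ℕ → ℝ) (v : ℕ → H) :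
    ∀ k, (∀ j ∈ Finset.Ico p k, ∀ a : ℕ → ℝ,
        cs * ‖v j‖ ≤ ‖v j - ∑ i ∈ Finset.Ico p j, a i • v i‖) →
      ∀ j ∈ Finset.Ico p k, |g j| * ‖v j‖ ≤
        cs⁻¹ * (1 + cs⁻¹) ^ (k - p) * ‖∑ i ∈ Finset.Ico p k, g i • v i‖ := by
  intro k
  induction k with
  | zero => simp
  | succ k ih =>
    intro hs j hj
    have hpk : p ≤ k := by
      have := Finset.mem_Ico.1 hj
      omega
    have hlast : |g k| * ‖v k‖ ≤ cs⁻¹ * ‖∑ i ∈ Finset.Ico p (k + 1), g i • v i‖ := by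
      rw [inv_mul_eq_div, le_div_iff₀ hcs, Finset.sum_Ico_succ_top hpk]
      rcases eq_or_ne (g k) 0 with h0 | h0
      · simp [h0]
      -- The last vector is compared with the element of the span for which `g k • (v k - ·)` is the
      -- whole combination.
      have h1 := hs k (Finset.mem_Ico.2 ⟨hpk, k.lt_succ_self⟩) (fun i => -((g k)⁻¹ * g i))
      have h2 : g k • (v k - ∑ i ∈ Finset.Ico p k, (-((g k)⁻¹ * g i)) • v i) =
          ∑ i ∈ Finset.Ico p k, g i • v i + g k • v k := by
        simp only [neg_smul, Finset.sum_neg_distrib, sub_neg_eq_add, smul_add, Finset.smul_sum,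
          smul_smul, mul_inv_cancel_left₀ h0]
        rw [add_comm]
      rw [← h2, norm_smul, Real.norm_eq_abs]
      nlinarith [abs_nonneg (g k)]
    have hc1 : 1 ≤ 1 + cs⁻¹ := by
      have := inv_pos.2 hcs
      linarith
    -- Dropping the last term costs a factor `1 + cs⁻¹`; iterating this through the induction
    -- produces the power.
    have hprev : ‖∑ i ∈ Finset.Ico p k, g i • v i‖ ≤
        (1 + cs⁻¹) * ‖∑ i ∈ Finset.Ico p (k + 1), g i • v i‖ := by
      have h1 : ∑ i ∈ Finset.Ico p k, g i • v i =
          ∑ i ∈ Finset.Ico p (k + 1), g i • v i - g k • v k := by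
        rw [Finset.sum_Ico_succ_top hpk, add_sub_cancel_right]
      rw [h1]
      refine (norm_sub_le _ _).trans ?_
      rw [norm_smul, Real.norm_eq_abs, add_mul, one_mul]
      linarith
    have hci : 0 < cs⁻¹ := inv_pos.2 hcs
    rcases (Nat.lt_succ_iff.1 (Finset.mem_Ico.1 hj).2).eq_or_lt with rfl | hjk
    · refine hlast.trans (mul_le_mul_of_nonneg_right ?_ (norm_nonneg _))
      exact le_mul_of_one_le_right hci.le (one_le_pow₀ hc1)
    · refine (ih (fun j hj a => hs j (Finset.mem_Ico.2
        ⟨(Finset.mem_Ico.1 hj).1, (Finset.mem_Ico.1 hj).2.trans k.lt_succ_self⟩) a) j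
        (Finset.mem_Ico.2 ⟨(Finset.mem_Ico.1 hj).1, hjk⟩)).trans ?_
      rw [Nat.succ_sub hpk, pow_succ, ← mul_assoc, mul_assoc (cs⁻¹ * _)]
      exact mul_le_mul_of_nonneg_left hprev (by positivity)

end anderson

/-! ### The Picard map of an abstract coupled system: a priori bounds and Lipschitz estimates -/

/-- The data of a decoupled Picard step on abstract spaces `V` and `T` of velocities and
temperatures, whose seminorms are those of the Hilbert space valued linear maps `gV` and `gT`. The
convection velocities range over the subspace `X`, and the equations are tested with `SV` and
`ST`. -/
structure PicardSystem (V T HV HT : Type*) [AddCommGroup V] [Module ℝ V] [AddCommGroup T]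
    [Module ℝ T] [NormedAddCommGroup HV] [InnerProductSpace ℝ HV] [NormedAddCommGroup HT]
    [InnerProductSpace ℝ HT] where
  X : Submodule ℝ V
  SV : Submodule ℝ V
  ST : Submodule ℝ T
  gV : V →ₗ[ℝ] HV
  gT : T →ₗ[ℝ] HT
  bV : X →ₗ[ℝ] V →ₗ[ℝ] V →ₗ[ℝ] ℝ
  bT : X →ₗ[ℝ] T →ₗ[ℝ] T →ₗ[ℝ] ℝ
  coupling : V → T →ₗ[ℝ] ℝ
  f : V → ℝ
  γ : T → ℝ
  ν : ℝ
  κ : ℝ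
  M : ℝ
  r : ℝ
  F : ℝ
  G : ℝ
  ν_pos : 0 < ν
  κ_pos : 0 < κ
  M_nonneg : 0 ≤ M
  r_nonneg : 0 ≤ r
  r_le : r ≤ κ
  F_nonneg : 0 ≤ F
  G_nonneg : 0 ≤ G
  bV_self : ∀ u v, bV u v v = 0
  bT_self : ∀ u φ, bT u φ φ = 0
  abs_bV_le : ∀ u v w, |bV u v w| ≤ M * ‖gV u.1‖ * ‖gV v‖ * ‖gV w‖
  abs_bT_le : ∀ u φ ψ, |bT u φ ψ| ≤ M * ‖gV u.1‖ * ‖gT φ‖ * ‖gT ψ‖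
  coupling_le : ∀ v θ, coupling v θ ≤ r * ‖gT θ‖ * ‖gV v‖
  f_le : ∀ v, f v ≤ F * ‖gV v‖
  γ_le : ∀ χ, γ χ ≤ G * ‖gT χ‖

namespace PicardSystem

variable {V T HV HT : Type*} [AddCommGroup V] [Module ℝ V] [AddCommGroup T]
  [Module ℝ T] [NormedAddCommGroup HV] [InnerProductSpace ℝ HV] [NormedAddCommGroup HT]
  [InnerProductSpace ℝ HT] (P : PicardSystem V T HV HT)

/-- The weighted gradients as an element of a Hilbert space. -/
def bMap : V × T →ₗ[ℝ] WithLp 2 (HV × HT) :=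
  (WithLp.linearEquiv 2 ℝ (HV × HT)).symm.toLinearMap ∘ₗ
    ((√P.ν • P.gV).prodMap (√P.κ • P.gT))

/-- The weighted norm of the gradients. -/
def bNorm (y : V × T) : ℝ := √(P.ν * ‖P.gV y.1‖ ^ 2 + P.κ * ‖P.gT y.2‖ ^ 2)

/-- Realizing the weighted seminorm in a Hilbert space makes the triangle inequality and Pythagoras
available. -/
theorem bNorm_eq (y : V × T) : P.bNorm y = ‖P.bMap y‖ := by
  rw [bNorm, WithLp.prod_norm_eq_of_L2]
  simp [bMap, norm_smul, mul_pow, Real.sq_sqrt P.ν_pos.le, Real.sq_sqrt P.κ_pos.le]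

theorem bNorm_nonneg (y : V × T) : 0 ≤ P.bNorm y := Real.sqrt_nonneg _

theorem bNorm_zero : P.bNorm 0 = 0 := by rw [bNorm_eq, map_zero, norm_zero]

theorem bNorm_add_le (y z : V × T) : P.bNorm (y + z) ≤ P.bNorm y + P.bNorm z := by
  simpa only [bNorm_eq, map_add] using norm_add_le (P.bMap y) (P.bMap z)

theorem bNorm_sub_le (y z : V × T) : P.bNorm (y - z) ≤ P.bNorm y + P.bNorm z := by
  simpa only [bNorm_eq, map_sub] using norm_sub_le (P.bMap y) (P.bMap z)

theorem bNorm_smul (c : ℝ) (y : V × T) : P.bNorm (c • y) = |c| * P.bNorm y := by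
  rw [bNorm_eq, bNorm_eq, map_smul, norm_smul, Real.norm_eq_abs]

theorem bNorm_sum_le {ι : Type*} (s : Finset ι) (y : ι → V × T) :
    P.bNorm (∑ i ∈ s, y i) ≤ ∑ i ∈ s, P.bNorm (y i) := by
  simpa only [bNorm_eq, map_sum] using norm_sum_le s fun i => P.bMap (y i)

theorem sqrt_mul_norm_gV_le (y : V × T) : √P.ν * ‖P.gV y.1‖ ≤ P.bNorm y := by
  refine Real.le_sqrt_of_sq_le ?_
  rw [mul_pow, Real.sq_sqrt P.ν_pos.le]
  have := mul_nonneg P.κ_pos.le (sq_nonneg ‖P.gT y.2‖)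
  linarith

/-- The smaller one of the diffusion coefficients. -/
def η : ℝ := min P.ν P.κ

/-- The a priori bound of the velocity. -/
def K₁ : ℝ := P.r * P.ν⁻¹ * P.κ⁻¹ * P.G + P.ν⁻¹ * P.F

/-- The a priori bound of the temperature. -/
def K₂ : ℝ := P.κ⁻¹ * P.G

/-- The Lipschitz constant of the Picard map. -/
def CG : ℝ := (√P.ν)⁻¹ * (√P.η)⁻¹ * P.M * √(2 * P.K₁ ^ 2 + 3 * P.K₂ ^ 2)

/-- The Lipschitz constant of the divided differences of the Picard map. -/
def CGhat : ℝ := 2 * P.ν⁻¹ * (√P.η ^ 3)⁻¹ * P.M ^ 2 * √(2 * P.K₁ ^ 2 + 9 * P.K₂ ^ 2)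

/-- `y` is the result of a Picard step from the velocity `u`. -/
structure IsStep (u : P.X) (y : V × T) : Prop where
  mem_velocity : y.1 ∈ P.SV
  mem_temperature : y.2 ∈ P.ST
  energy : ∀ χ ∈ P.ST, P.bT u y.2 χ + P.κ * inner ℝ (P.gT y.2) (P.gT χ) = P.γ χ
  momentum : ∀ v ∈ P.SV, P.bV u y.1 v + P.ν * inner ℝ (P.gV y.1) (P.gV v) =
    P.coupling v y.2 + P.f v

variable {P}

theorem η_pos : 0 < P.η := lt_min P.ν_pos P.κ_pos

theorem K₁_nonneg : 0 ≤ P.K₁ := by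
  have h1 := P.F_nonneg
  have h2 := P.G_nonneg
  have h3 := P.ν_pos
  have h4 := P.κ_pos
  have h5 := P.r_nonneg
  rw [K₁]
  positivity

theorem K₂_nonneg : 0 ≤ P.K₂ :=
  mul_nonneg (inv_nonneg.2 P.κ_pos.le) P.G_nonneg

theorem CG_nonneg : 0 ≤ P.CG := by
  have := P.M_nonneg
  rw [CG]; positivity

theorem CGhat_nonneg : 0 ≤ P.CGhat := by
  have h3 := P.ν_pos
  rw [CGhat]; positivity

theorem r_mul_inv_le : P.r * P.κ⁻¹ ≤ 1 := by
  rw [← div_eq_mul_inv, div_le_one P.κ_pos]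
  exact P.r_le

theorem IsStep.norm_gT_le {u : P.X} {y : V × T} (h : P.IsStep u y) : ‖P.gT y.2‖ ≤ P.K₂ := by
  rw [K₂, ← div_eq_inv_mul, le_div_iff₀ P.κ_pos, mul_comm]
  refine energy_bound (P.bT_self u _) P.G_nonneg ?_
  rw [h.energy y.2 h.mem_temperature]
  exact P.γ_le _

/-- Test with the solution itself; the temperature bound controls the buoyancy load. -/
theorem IsStep.norm_gV_le {u : P.X} {y : V × T} (h : P.IsStep u y) : ‖P.gV y.1‖ ≤ P.K₁ := by
  have hν := P.ν_pos
  have hκ := P.κ_pos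
  have h1 : P.K₁ = (P.r * P.K₂ + P.F) / P.ν := by
    rw [K₁, K₂]; field_simp
  rw [h1, le_div_iff₀ hν, mul_comm]
  refine energy_bound (P.bV_self u _) (add_nonneg (mul_nonneg P.r_nonneg K₂_nonneg)
    P.F_nonneg) ?_
  rw [h.momentum y.1 h.mem_velocity, add_mul]
  refine add_le_add ((P.coupling_le _ _).trans ?_) (P.f_le _)
  exact mul_le_mul_of_nonneg_right (mul_le_mul_of_nonneg_left h.norm_gT_le P.r_nonneg)
    (norm_nonneg _)

section combination

variable {ι : Type*} (s : Finset ι) (a : ι → ℝ) (u u' : ι → P.X) (y y' : ι → V × T)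

/-- The forcing `γ` is common to all the equations and cancels, so the remainder `R` is zero. -/
theorem norm_gT_combination_le
    (hy : ∀ i ∈ s, P.IsStep (u i) (y i)) (hy' : ∀ i ∈ s, P.IsStep (u' i) (y' i))
    (U₀ : P.X) (y₀ : V × T) :
    P.κ * ‖P.gT (∑ i ∈ s, a i • ((y' i).2 - (y i).2))‖ ≤
      P.M * ‖P.gV (∑ i ∈ s, a i • (u' i - u i) : P.X).1‖ * ‖P.gT y₀.2‖ +
      ∑ i ∈ s, |a i| * (P.M * (‖P.gV (u' i - u i : P.X).1‖ * ‖P.gT (y₀.2 - (y i).2)‖ +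
        ‖P.gV (u' i - U₀ : P.X).1‖ * ‖P.gT ((y' i).2 - (y i).2)‖)) := by
  have := energy_bound_sum (c := P.bT) (g := P.gT) (p := fun u => ‖P.gV u.1‖) (μ := P.κ) (M := P.M)
    (R := 0) (S := P.ST) P.bT_self (fun _ => norm_nonneg _) P.M_nonneg P.abs_bT_le s a u u'
    (fun i => (y i).2) (fun i => (y' i).2) (fun _ => P.γ) (fun _ => P.γ)
    (fun i hi => (hy i hi).mem_temperature) (fun i hi => (hy' i hi).mem_temperature)
    (fun i hi => (hy i hi).energy) (fun i hi => (hy' i hi).energy)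
    le_rfl (fun z => by simp) U₀ y₀.2
  simpa only [add_zero] using this

/-- The forcing `f` cancels and the coupling is linear in the temperature, so only the corresponding
temperature combination survives as a load. -/
theorem norm_gV_combination_le
    (hy : ∀ i ∈ s, P.IsStep (u i) (y i)) (hy' : ∀ i ∈ s, P.IsStep (u' i) (y' i))
    (U₀ : P.X) (y₀ : V × T) :
    P.ν * ‖P.gV (∑ i ∈ s, a i • ((y' i).1 - (y i).1))‖ ≤
      P.M * ‖P.gV (∑ i ∈ s, a i • (u' i - u i) : P.X).1‖ * ‖P.gV y₀.1‖ +
      ∑ i ∈ s, |a i| * (P.M * (‖P.gV (u' i - u i : P.X).1‖ * ‖P.gV (y₀.1 - (y i).1)‖ +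
        ‖P.gV (u' i - U₀ : P.X).1‖ * ‖P.gV ((y' i).1 - (y i).1)‖)) +
      P.r * ‖P.gT (∑ i ∈ s, a i • ((y' i).2 - (y i).2))‖ := by
  refine energy_bound_sum (c := P.bV) (g := P.gV) (p := fun u => ‖P.gV u.1‖) (μ := P.ν) (M := P.M)
    (S := P.SV) P.bV_self (fun _ => norm_nonneg _) P.M_nonneg P.abs_bV_le
    s a u u' (fun i => (y i).1) (fun i => (y' i).1)
    (fun i z => P.coupling z (y i).2 + P.f z) (fun i z => P.coupling z (y' i).2 + P.f z)
    (fun i hi => (hy i hi).mem_velocity) (fun i hi => (hy' i hi).mem_velocity)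
    (fun i hi => (hy i hi).momentum) (fun i hi => (hy' i hi).momentum)
    (mul_nonneg P.r_nonneg (norm_nonneg _)) (fun z => ?_) U₀ y₀.1
  refine le_trans (le_of_eq ?_) (P.coupling_le z _)
  simp only [map_sum, map_smul, map_sub, smul_eq_mul, add_sub_add_right_eq_sub]

end combination

/-- Lipschitz estimates for the Picard map, separately for the temperature and the velocity. -/
theorem IsStep.norm_sub_le
     {u u' : P.X} {y y' : V × T}
    (h : P.IsStep u y) (h' : P.IsStep u' y') :
    ‖P.gT (y'.2 - y.2)‖ ≤ P.κ⁻¹ * (P.M * P.K₂ * ‖P.gV (u' - u : P.X).1‖) ∧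
    ‖P.gV (y'.1 - y.1)‖ ≤ P.ν⁻¹ * (P.M * (P.K₁ + P.K₂) * ‖P.gV (u' - u : P.X).1‖) := by
  have hM0 := P.M_nonneg
  have h1 := norm_gT_combination_le (s := {()}) (fun _ => 1) (fun _ => u) (fun _ => u')
    (fun _ => y) (fun _ => y') (fun _ _ => h) (fun _ _ => h') u' y
  have h2 := norm_gV_combination_le (s := {()}) (fun _ => 1) (fun _ => u) (fun _ => u')
    (fun _ => y) (fun _ => y') (fun _ _ => h) (fun _ _ => h') u' y
  simp only [Finset.sum_singleton, one_smul, sub_self, map_zero, norm_zero, mul_zero, zero_mul,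
    add_zero, ZeroMemClass.coe_zero] at h1 h2
  have hT : ‖P.gT (y'.2 - y.2)‖ ≤ P.κ⁻¹ * (P.M * P.K₂ * ‖P.gV (u' - u : P.X).1‖) := by
    rw [← div_eq_inv_mul, le_div_iff₀ P.κ_pos, mul_comm]
    refine h1.trans ?_
    rw [mul_right_comm]
    gcongr
    exact h.norm_gT_le
  refine ⟨hT, ?_⟩
  rw [← div_eq_inv_mul, le_div_iff₀ P.ν_pos, mul_comm]
  refine h2.trans ?_
  -- Since `r ≤ κ`, the coupling at most cancels the division by `κ` in the temperature estimate;
  -- this adds `K₂` to `K₁`.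
  have h3 : P.r * ‖P.gT (y'.2 - y.2)‖ ≤ P.M * P.K₂ * ‖P.gV (u' - u : P.X).1‖ := by
    refine (mul_le_mul_of_nonneg_left hT P.r_nonneg).trans ?_
    rw [← mul_assoc]
    exact mul_le_of_le_one_left (mul_nonneg (mul_nonneg hM0 K₂_nonneg) (norm_nonneg _))
      r_mul_inv_le
  have h4 : P.M * ‖P.gV (u' - u : P.X).1‖ * ‖P.gV y.1‖ ≤
      P.M * ‖P.gV (u' - u : P.X).1‖ * P.K₁ := by
    gcongr
    exact h.norm_gV_le
  linarith

theorem sqrt_add_sq_le (a b c d : ℝ) :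
    √((a + b) ^ 2 + (c + d) ^ 2) ≤ √(a ^ 2 + c ^ 2) + √(b ^ 2 + d ^ 2) := by
  refine Real.sqrt_le_iff.2 ⟨by positivity, ?_⟩
  have h1 := Real.sq_sqrt (by positivity : 0 ≤ a ^ 2 + c ^ 2)
  have h2 := Real.sq_sqrt (by positivity : 0 ≤ b ^ 2 + d ^ 2)
  have h3 : a * b + c * d ≤ √(a ^ 2 + c ^ 2) * √(b ^ 2 + d ^ 2) := by
    rw [← Real.sqrt_mul (by positivity)]
    refine Real.le_sqrt_of_sq_le ?_
    nlinarith [sq_nonneg (a * d - c * b)]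
  nlinarith

/-- Estimate of a linear combination of differences of Picard updates: the first term is of first
order in the differences of the arguments, with the constant `C_G`, and the sum is of second order,
with the constant `Ĉ_G`. -/
theorem bNorm_combination_le {ι : Type*} (s : Finset ι) (a : ι → ℝ) (x x' y y' : ι → V × T)
    (hx : ∀ i, (x i).1 ∈ P.X) (hx' : ∀ i, (x' i).1 ∈ P.X)
    (hy : ∀ i ∈ s, P.IsStep ⟨(x i).1, hx i⟩ (y i)) (hy' : ∀ i ∈ s, P.IsStep ⟨(x' i).1, hx' i⟩ (y' i))
    (x₀ x₀' y₀ : V × T) (hx₀ : x₀.1 ∈ P.X) (hx₀' : x₀'.1 ∈ P.X)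
    (hy₀ : P.IsStep ⟨x₀.1, hx₀⟩ y₀) :
    P.bNorm (∑ i ∈ s, a i • (y' i - y i)) ≤
      P.CG * P.bNorm (∑ i ∈ s, a i • (x' i - x i)) +
      P.CGhat / 2 * ∑ i ∈ s, |a i| * (P.bNorm (x' i - x i) *
        (P.bNorm (x₀ - x i) + P.bNorm (x' i - x₀'))) := by
  have hν := P.ν_pos
  have hκ := P.κ_pos
  have hη : 0 < P.η := η_pos
  have hM0 := P.M_nonneg
  have hK1 : 0 ≤ P.K₁ := K₁_nonneg
  have hK2 : 0 ≤ P.K₂ := K₂_nonneg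
  set u : ι → P.X := fun i => ⟨(x i).1, hx i⟩ with hu
  set u' : ι → P.X := fun i => ⟨(x' i).1, hx' i⟩ with hu'
  set U₀ : P.X := ⟨x₀.1, hx₀⟩ with hU₀
  set U₀' : P.X := ⟨x₀'.1, hx₀'⟩ with hU₀'
  have hsd' (i : ι) (hi : i ∈ s) := IsStep.norm_sub_le (u := u i) (u' := u' i)
    (hy i hi) (hy' i hi)
  have hsd₀ (i : ι) (hi : i ∈ s) := IsStep.norm_sub_le (u := u i) (u' := U₀)
    (hy i hi) hy₀
  set q : ℝ := ‖P.gV (∑ i ∈ s, a i • (u' i - u i) : P.X).1‖ with hq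
  set S : ℝ := ∑ i ∈ s, |a i| * (‖P.gV (u' i - u i : P.X).1‖ *
    (‖P.gV (U₀ - u i : P.X).1‖ + ‖P.gV (u' i - U₀' : P.X).1‖)) with hS
  have hq0 : 0 ≤ q := norm_nonneg _
  have hS0 : 0 ≤ S := Finset.sum_nonneg fun i _ => by positivity
  set D : V × T := ∑ i ∈ s, a i • (y' i - y i) with hD
  have hD1 : D.1 = ∑ i ∈ s, a i • ((y' i).1 - (y i).1) := by
    rw [hD, Prod.fst_sum]; rfl
  have hD2 : D.2 = ∑ i ∈ s, a i • ((y' i).2 - (y i).2) := by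
    rw [hD, Prod.snd_sum]; rfl
  -- The two reference points are independent: the convection velocity comes from `x₀'`, while `y₀`
  -- is the Picard update of `x₀`.
  have hT := norm_gT_combination_le s a u u' y y' hy hy' U₀' y₀
  have hV := norm_gV_combination_le s a u u' y y' hy hy' U₀' y₀
  rw [← hD2, ← hq] at hT
  rw [← hD1, ← hD2, ← hq] at hV
  have hT1 : P.κ * ‖P.gT D.2‖ ≤ P.M * P.K₂ * q + P.M ^ 2 * P.η⁻¹ * P.K₂ * S := by
    refine hT.trans (add_le_add ?_ ?_)
    · rw [mul_right_comm]
      gcongr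
      exact hy₀.norm_gT_le
    · rw [hS, Finset.mul_sum]
      refine Finset.sum_le_sum fun i hi => ?_
      have hηκ : P.κ⁻¹ ≤ P.η⁻¹ := inv_anti₀ hη (min_le_right _ _)
      calc _ ≤ |a i| * (P.M * (‖P.gV (u' i - u i : P.X).1‖ *
              (P.η⁻¹ * (P.M * P.K₂ * ‖P.gV (U₀ - u i : P.X).1‖)) +
            ‖P.gV (u' i - U₀' : P.X).1‖ *
              (P.η⁻¹ * (P.M * P.K₂ * ‖P.gV (u' i - u i : P.X).1‖)))) := by
            gcongr
            · exact (hsd₀ i hi).1.trans (by gcongr)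
            · exact (hsd' i hi).1.trans (by gcongr)
        _ = _ := by ring
  have hRi : P.r * ‖P.gT D.2‖ ≤ P.M * P.K₂ * q + P.M ^ 2 * P.η⁻¹ * P.K₂ * S := by
    refine le_trans ?_ hT1
    have := r_mul_inv_le (P := P)
    rw [← div_eq_mul_inv, div_le_one hκ] at this
    gcongr
  have hV1 : P.ν * ‖P.gV D.1‖ ≤ P.M * (P.K₁ + P.K₂) * q +
      P.M ^ 2 * P.η⁻¹ * (P.K₁ + 2 * P.K₂) * S := by
    have h1 : P.M * q * ‖P.gV y₀.1‖ ≤ P.M * q * P.K₁ := by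
      gcongr
      exact hy₀.norm_gV_le
    have h2 : ∑ i ∈ s, |a i| * (P.M * (‖P.gV (u' i - u i : P.X).1‖ * ‖P.gV (y₀.1 - (y i).1)‖ +
        ‖P.gV (u' i - U₀' : P.X).1‖ * ‖P.gV ((y' i).1 - (y i).1)‖)) ≤
        P.M ^ 2 * P.η⁻¹ * (P.K₁ + P.K₂) * S := by
      rw [hS, Finset.mul_sum]
      refine Finset.sum_le_sum fun i hi => ?_
      have hην : P.ν⁻¹ ≤ P.η⁻¹ := inv_anti₀ hη (min_le_left _ _)
      calc _ ≤ |a i| * (P.M * (‖P.gV (u' i - u i : P.X).1‖ *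
              (P.η⁻¹ * (P.M * (P.K₁ + P.K₂) * ‖P.gV (U₀ - u i : P.X).1‖)) +
            ‖P.gV (u' i - U₀' : P.X).1‖ *
              (P.η⁻¹ * (P.M * (P.K₁ + P.K₂) * ‖P.gV (u' i - u i : P.X).1‖)))) := by
            gcongr
            · exact (hsd₀ i hi).2.trans (by gcongr)
            · exact (hsd' i hi).2.trans (by gcongr)
        _ = _ := by ring
    linarith
  -- Passes from `μ A ≤ B` to `√μ A ≤ B / √η`, the weighting used by the `B`-norm, in squared form.
  have hscale {μ A B : ℝ} (hμ : P.η ≤ μ) (hA : 0 ≤ A) (h : μ * A ≤ B) :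
      μ * A ^ 2 ≤ ((√P.η)⁻¹ * B) ^ 2 := by
    have hμ0 : 0 < μ := hη.trans_le hμ
    rw [mul_pow, inv_pow, Real.sq_sqrt hη.le, ← div_eq_inv_mul, le_div_iff₀ hη]
    have h1 : (μ * A) ^ 2 ≤ B ^ 2 := pow_le_pow_left₀ (by positivity) h 2
    have h2 : μ * A ^ 2 * P.η ≤ μ * A ^ 2 * μ := by gcongr
    linarith
  have hB : P.bNorm D ≤ (√P.η)⁻¹ * (P.M * q) * √(2 * P.K₁ ^ 2 + 3 * P.K₂ ^ 2) +
      (√P.η)⁻¹ * (P.M ^ 2 * P.η⁻¹ * S) * √(2 * P.K₁ ^ 2 + 9 * P.K₂ ^ 2) := by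
    rw [bNorm]
    refine (Real.sqrt_le_sqrt (add_le_add (hscale (min_le_left _ _) (norm_nonneg _) hV1)
      (hscale (min_le_right _ _) (norm_nonneg _) hT1))).trans ?_
    rw [mul_add (√P.η)⁻¹, mul_add (√P.η)⁻¹]
    refine (sqrt_add_sq_le _ _ _ _).trans (add_le_add ?_ ?_)
    · refine Real.sqrt_le_iff.2 ⟨by positivity, ?_⟩
      rw [mul_pow _ (√(2 * P.K₁ ^ 2 + 3 * P.K₂ ^ 2)), Real.sq_sqrt (by positivity)]
      -- Young's inequality `2 K₁ K₂ ≤ K₁² + K₂²` is the source of the coefficients 2 and 3 in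
      -- `C_G`; below, `4 K₁ K₂ ≤ K₁² + 4 K₂²` gives 2 and 9 in `Ĉ_G`.
      have : (P.K₁ + P.K₂) ^ 2 + P.K₂ ^ 2 ≤ 2 * P.K₁ ^ 2 + 3 * P.K₂ ^ 2 := by
        nlinarith [sq_nonneg (P.K₁ - P.K₂)]
      calc _ = ((√P.η)⁻¹ * (P.M * q)) ^ 2 * ((P.K₁ + P.K₂) ^ 2 + P.K₂ ^ 2) := by ring
        _ ≤ _ := by gcongr
    · refine Real.sqrt_le_iff.2 ⟨by positivity, ?_⟩
      rw [mul_pow _ (√(2 * P.K₁ ^ 2 + 9 * P.K₂ ^ 2)), Real.sq_sqrt (by positivity)]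
      have : (P.K₁ + 2 * P.K₂) ^ 2 + P.K₂ ^ 2 ≤ 2 * P.K₁ ^ 2 + 9 * P.K₂ ^ 2 := by
        nlinarith [sq_nonneg (P.K₁ - 2 * P.K₂)]
      calc _ = ((√P.η)⁻¹ * (P.M ^ 2 * P.η⁻¹ * S)) ^ 2 *
            ((P.K₁ + 2 * P.K₂) ^ 2 + P.K₂ ^ 2) := by ring
        _ ≤ _ := by gcongr
  -- Only velocity differences occur on the right, so each one is converted to the `B`-norm at the
  -- price of `ν^{-1/2}`.
  have hqB : √P.ν * q ≤ P.bNorm (∑ i ∈ s, a i • (x' i - x i)) := by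
    refine le_trans (le_of_eq ?_) (P.sqrt_mul_norm_gV_le _)
    rw [hq, Prod.fst_sum, AddSubmonoidClass.coe_finsetSum]
    rfl
  have hSB : P.ν * S ≤ ∑ i ∈ s, |a i| * (P.bNorm (x' i - x i) *
        (P.bNorm (x₀ - x i) + P.bNorm (x' i - x₀'))) := by
    rw [hS, Finset.mul_sum]
    refine Finset.sum_le_sum fun i _ => ?_
    have h1 := P.sqrt_mul_norm_gV_le (x' i - x i)
    have h2 := P.sqrt_mul_norm_gV_le (x₀ - x i)
    have h3 := P.sqrt_mul_norm_gV_le (x' i - x₀')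
    have h0 := P.bNorm_nonneg (x' i - x i)
    calc _ = |a i| * ((√P.ν * ‖P.gV (x' i - x i).1‖) *
          (√P.ν * ‖P.gV (x₀ - x i).1‖ + √P.ν * ‖P.gV (x' i - x₀').1‖)) := by
          rw [← mul_add, mul_mul_mul_comm, Real.mul_self_sqrt hν.le, mul_left_comm]
          rfl
      _ ≤ _ := by gcongr
  have hsν := Real.sqrt_pos.2 hν
  have hsη := Real.sqrt_pos.2 hη
  have e1 : (√P.η)⁻¹ * (P.M * q) * √(2 * P.K₁ ^ 2 + 3 * P.K₂ ^ 2) = P.CG * (√P.ν * q) := by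
    rw [CG]; field_simp
  have e2 : (√P.η)⁻¹ * (P.M ^ 2 * P.η⁻¹ * S) * √(2 * P.K₁ ^ 2 + 9 * P.K₂ ^ 2) =
      P.CGhat / 2 * (P.ν * S) := by
    have : P.η⁻¹ = (√P.η ^ 2)⁻¹ := by rw [Real.sq_sqrt hη.le]
    rw [CGhat, this]; field_simp
  rw [e1, e2] at hB
  exact hB.trans (add_le_add (mul_le_mul_of_nonneg_left hqB (CG_nonneg))
    (mul_le_mul_of_nonneg_left hSB (div_nonneg CGhat_nonneg zero_le_two)))

/-- The Picard map is Lipschitz with the constant `C_G` in the `B`-norm. -/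
theorem bNorm_picard_sub_le
     {x x' y y' : V × T} (hx : x.1 ∈ P.X) (hx' : x'.1 ∈ P.X)
    (hy : P.IsStep ⟨x.1, hx⟩ y) (hy' : P.IsStep ⟨x'.1, hx'⟩ y') :
    P.bNorm (y' - y) ≤ P.CG * P.bNorm (x' - x) := by
  have h := bNorm_combination_le (s := {()}) (fun _ => 1) (fun _ => x) (fun _ => x') (fun _ => y)
    (fun _ => y') (fun _ => hx) (fun _ => hx') (fun _ _ => hy) (fun _ _ => hy')
    x x' y hx hx' hy
  have h0 : P.bNorm 0 = 0 := by rw [bNorm_eq, map_zero, norm_zero]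
  simpa only [Finset.sum_singleton, one_smul, sub_self, h0, add_zero, mul_zero] using h

end PicardSystem

/-! ### Index bookkeeping for averages and sums -/

theorem depth_lt {k : ℕ} (m : ℕ) (hk : 1 ≤ k) : depth m k < k := by
  rw [depth]; omega

theorem average_sub {V : Type*} [AddCommGroup V] [Module ℝ V] (m k : ℕ) (a : ℕ → ℝ)
    (y z : ℕ → V) : average m k a (fun j => y j - z j) = average m k a y - average m k a z := by
  simp only [average, smul_sub, Finset.sum_sub_distrib]
  abel

/-- The residual relation is prescribed only from index 1 on, and an average at `k ≥ 1` never
reaches index 0. -/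
theorem average_congr {V : Type*} [AddCommGroup V] [Module ℝ V] {m k : ℕ} (hk : 1 ≤ k)
    (a : ℕ → ℝ) {y z : ℕ → V} (h : ∀ j, 1 ≤ j → y j = z j) :
    average m k a y = average m k a z := by
  rw [average, average, h k hk]
  congr 1
  refine Finset.sum_congr rfl fun j hj => ?_
  have := depth_lt m hk
  have := (Finset.mem_Ico.1 hj).1
  rw [h j (by omega)]

theorem sum_Ico_succ_ite {A : Type*} [AddCommMonoid A] {p k : ℕ} (hpk : p ≤ k) (g : ℕ → ℝ)
    (F : ℝ → ℕ → A) : ∑ i ∈ Finset.Ico p (k + 1), F (if i = k then 1 else g i) i =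
      ∑ i ∈ Finset.Ico p k, F (g i) i + F 1 k := by
  rw [Finset.sum_Ico_succ_top hpk, if_pos rfl]
  congr 1
  exact Finset.sum_congr rfl fun i hi => by rw [if_neg (Finset.mem_Ico.1 hi).2.ne]

/-- All the weights on the right, `1`, `2 (k - j)` and `k - p`, are at least 1; for the last one
this uses `p < k`. -/
theorem sum_Ico_le_weighted_sum {p k : ℕ} (hpk : p < k) {W : ℕ → ℝ}
    (hW : ∀ n ∈ Finset.Ico p (k + 1), 0 ≤ W n) :
    ∑ n ∈ Finset.Ico p (k + 1), W n ≤
      W k + 2 * ∑ j ∈ Finset.Ico (p + 1) k, ((k : ℝ) - j) * W j + ((k - p : ℕ) : ℝ) * W p := by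
  rw [Finset.sum_Ico_succ_top hpk.le, Finset.sum_eq_sum_Ico_succ_bot hpk, Finset.mul_sum]
  have h1 : ∑ n ∈ Finset.Ico (p + 1) k, W n ≤
      ∑ j ∈ Finset.Ico (p + 1) k, 2 * (((k : ℝ) - j) * W j) := by
    refine Finset.sum_le_sum fun j hj => ?_
    obtain ⟨hj1, hj2⟩ := Finset.mem_Ico.1 hj
    have hj3 : (j : ℝ) + 1 ≤ k := by exact_mod_cast hj2
    have hj4 := hW j (Finset.mem_Ico.2 ⟨by omega, by omega⟩)
    nlinarith
  have h2 : W p ≤ ((k - p : ℕ) : ℝ) * W p := by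
    refine le_mul_of_one_le_left (hW p (Finset.mem_Ico.2 ⟨le_rfl, by omega⟩)) ?_
    exact_mod_cast Nat.sub_pos_of_lt hpk
  linarith

/-! ### The accelerated iteration of the abstract system -/

namespace PicardSystem

variable {V T HV HT : Type*} [AddCommGroup V] [Module ℝ V] [AddCommGroup T]
  [Module ℝ T] [NormedAddCommGroup HV] [InnerProductSpace ℝ HV] [NormedAddCommGroup HT]
  [InnerProductSpace ℝ HT] (P : PicardSystem V T HV HT)

/-- The sequences of an Anderson accelerated Picard iteration of depth `m`. -/
structure IsRun (m : ℕ) (β : ℕ → ℝ) (x xt w : ℕ → V × T) (α : ℕ → ℕ → ℝ) : Prop where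
  mem_velocity : ∀ n, (x n).1 ∈ P.X
  damping : ∀ k, 1 ≤ k → 0 < β k ∧ β k ≤ 1
  picard : ∀ k, 1 ≤ k → P.IsStep ⟨(x (k - 1)).1, mem_velocity _⟩ (xt k)
  residual : ∀ k, 1 ≤ k → w k = xt k - x (k - 1)
  optimal : ∀ k, 1 ≤ k → ∀ a : ℕ → ℝ,
    P.bNorm (average m k (α k) w) ≤ P.bNorm (average m k a w)
  update : ∀ k, 1 ≤ k →
    x k = average m k (α k) (fun j => x (j - 1)) + β k • average m k (α k) w

/-- The ratio of the optimized residual and the residual. -/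
def gain (m : ℕ) (w : ℕ → V × T) (α : ℕ → ℕ → ℝ) (k : ℕ) : ℝ :=
  P.bNorm (average m k (α k) w) / P.bNorm (w k)

/-- The sine of the angle between `y` and the subspace `S` is at least `c`. -/
def SineGE (c : ℝ) (y : V × T) (S : Submodule ℝ (V × T)) : Prop :=
  ∀ g ∈ S, c * P.bNorm y ≤ P.bNorm (y - g)

/-- The constant in the bound of the individual terms of the optimal combination. -/
def termConst (m : ℕ) (cs CG : ℝ) : ℝ := cs⁻¹ * (1 + cs⁻¹) ^ m / (1 - CG)

theorem termConst_nonneg (m : ℕ) {cs CG : ℝ} (hcs : 0 < cs) (hCG : CG < 1) :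
    0 ≤ termConst m cs CG := by
  have := sub_pos.2 hCG
  rw [termConst]
  positivity

variable {P} {m : ℕ} {β : ℕ → ℝ} {x xt w : ℕ → V × T} {α : ℕ → ℕ → ℝ}

theorem average_succ_pred (n : ℕ) (a : ℕ → ℝ) :
    average m n a (fun j => x (j - 1)) = x (n - 1) -
      ∑ i ∈ Finset.Ico (n - depth m n) n, diffCoeff m n a i • (x i - x (i - 1)) := by
  rw [average_eq]
  simp only [Nat.add_sub_cancel]

namespace IsRun

variable (h : P.IsRun m β x xt w α)
include h

theorem bNorm_average_le {n : ℕ} (hn : 1 ≤ n) :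
    P.bNorm (average m n (α n) w) ≤ P.bNorm (w n) := by
  have := h.optimal n hn 0
  simpa [average] using this

/-- Also valid for a vanishing residual, because the optimized residual is then zero too. -/
theorem gain_mul {n : ℕ} (hn : 1 ≤ n) :
    P.gain m w α n * P.bNorm (w n) = P.bNorm (average m n (α n) w) := by
  refine div_mul_cancel_of_imp fun h0 => ?_
  exact le_antisymm ((h.bNorm_average_le hn).trans h0.le) (P.bNorm_nonneg _)

/-- The distance of the residual and the optimized residual. -/
theorem bNorm_sum_eq {n : ℕ} (hn : 1 ≤ n) :
    P.bNorm (∑ i ∈ Finset.Ico (n - depth m n) n, diffCoeff m n (α n) i • (w (i + 1) - w i)) =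
      √(1 - P.gain m w α n ^ 2) * P.bNorm (w n) := by
  set c := ∑ i ∈ Finset.Ico (n - depth m n) n, diffCoeff m n (α n) i • (w (i + 1) - w i) with hc
  -- Scaling the coefficients by `t` moves the average along the line through `w n` in direction
  -- `c`, so optimality can be tested on multiples of `c` alone.
  have h1 (t : ℝ) : average m n (fun j => t * α n j) w = w n - t • c := by
    rw [average_eq, hc, Finset.smul_sum]
    simp only [diffCoeff_mul, mul_smul]
  have h2 : average m n (α n) w = w n - c := average_eq _ _ _ _
  have h3 : P.bNorm c ^ 2 = P.bNorm (w n) ^ 2 - P.bNorm (average m n (α n) w) ^ 2 := by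
    rw [h2]
    simp only [bNorm_eq, map_sub]
    refine norm_sq_of_isMin fun t => ?_
    have := h.optimal n hn fun j => t * α n j
    rw [h1, h2] at this
    simpa only [bNorm_eq, map_sub, map_smul] using this
  rw [← Real.sqrt_sq (P.bNorm_nonneg c), h3, ← h.gain_mul hn]
  conv_rhs => rw [← Real.sqrt_sq (P.bNorm_nonneg (w n))]
  rw [← Real.sqrt_mul' _ (sq_nonneg _)]
  congr 1
  ring

/-- The step is a difference of Picard updates minus a difference of residuals; the former is at
most `C_G` times the step itself and is absorbed. -/
theorem bNorm_step_le (hCG : P.CG < 1) {i : ℕ} (hi : 1 ≤ i) :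
    P.bNorm (x i - x (i - 1)) ≤ P.bNorm (w (i + 1) - w i) / (1 - P.CG) := by
  have h1 : x i - x (i - 1) = (xt (i + 1) - xt i) - (w (i + 1) - w i) := by
    rw [h.residual i hi, h.residual (i + 1) (by omega), Nat.add_sub_cancel]
    abel
  have h2 := bNorm_picard_sub_le (h.mem_velocity (i - 1)) (h.mem_velocity i) (h.picard i hi)
    (h.picard (i + 1) (by omega))
  have h3 := P.bNorm_sub_le (xt (i + 1) - xt i) (w (i + 1) - w i)
  rw [← h1] at h3
  rw [le_div_iff₀ (sub_pos.2 hCG)]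
  linarith

/-- Splits off the undamped part of `w^α`; the rest, the new update minus the averaged updates, is a
combination of consecutive update differences. -/
theorem residual_succ_eq {k : ℕ} (hk : 1 ≤ k) :
    w (k + 1) = (1 - β k) • average m k (α k) w + ((xt (k + 1) - xt k) +
      ∑ i ∈ Finset.Ico (k - depth m k) k, diffCoeff m k (α k) i • (xt (i + 1) - xt i)) := by
  have h1 : average m k (α k) w = average m k (α k) xt - average m k (α k) fun j => x (j - 1) := by
    rw [← average_sub]
    exact average_congr hk _ h.residual
  have h2 := average_eq m k (α k) xt
  have h3 := h.update k hk
  rw [h.residual (k + 1) (by omega), Nat.add_sub_cancel, h3, sub_smul, one_smul]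
  have h4 : ∑ i ∈ Finset.Ico (k - depth m k) k, diffCoeff m k (α k) i • (xt (i + 1) - xt i) =
      xt k - average m k (α k) xt := by
    rw [h2, sub_sub_cancel]
  rw [h4]
  conv_rhs => enter [1, 1]; rw [h1]
  abel

theorem bNorm_residual_succ_le {k : ℕ} (hk : 1 ≤ k) :
    P.bNorm (w (k + 1)) ≤
      (1 - β k + P.CG * β k) * (P.gain m w α k * P.bNorm (w k)) +
      P.CGhat / 2 * ∑ i ∈ Finset.Ico (k - depth m k) k, |diffCoeff m k (α k) i| *
        (P.bNorm (x i - x (i - 1)) *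
          (P.bNorm (x (k - 1) - x (i - 1)) + P.bNorm (x i - x k))) := by
  set p := k - depth m k with hp
  have hp1 : 1 ≤ p := by
    have := depth_lt m hk
    omega
  have hpk : p ≤ k := Nat.sub_le _ _
  -- The newest difference enters with coefficient 1. With references `x (k - 1)` and `x k` its
  -- quadratic term vanishes, so the second-order sum stops before `k`.
  set a : ℕ → ℝ := fun i => if i = k then 1 else diffCoeff m k (α k) i with ha
  have hmem (i : ℕ) (hi : i ∈ Finset.Ico p (k + 1)) : 1 ≤ i :=
    hp1.trans (Finset.mem_Ico.1 hi).1
  have hcomb := bNorm_combination_le (Finset.Ico p (k + 1)) a (fun i => x (i - 1)) x xt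
    (fun i => xt (i + 1)) (fun i => h.mem_velocity _) h.mem_velocity
    (fun i hi => h.picard i (hmem i hi)) (fun i _ => h.picard (i + 1) (by omega))
    (x (k - 1)) (x k) (xt k) (h.mem_velocity _) (h.mem_velocity _) (h.picard k hk)
  rw [sum_Ico_succ_ite hpk _ fun c i => c • (xt (i + 1) - xt i),
    sum_Ico_succ_ite hpk _ fun c i => c • (x i - x (i - 1)),
    sum_Ico_succ_ite hpk _ fun c i => |c| * (P.bNorm (x i - x (i - 1)) *
      (P.bNorm (x (k - 1) - x (i - 1)) + P.bNorm (x i - x k)))] at hcomb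
  simp only [one_smul, sub_self, bNorm_zero, add_zero, mul_zero] at hcomb
  have hupd : ∑ i ∈ Finset.Ico p k, diffCoeff m k (α k) i • (x i - x (i - 1)) +
      (x k - x (k - 1)) = β k • average m k (α k) w := by
    conv_lhs => enter [2]; rw [h.update k hk, average_succ_pred]
    abel
  have hβ := h.damping k hk
  rw [hupd, bNorm_smul, abs_of_pos hβ.1] at hcomb
  rw [h.residual_succ_eq hk, h.gain_mul hk, add_comm (xt (k + 1) - xt k)]
  refine (P.bNorm_add_le _ _).trans ?_
  rw [bNorm_smul, abs_of_nonneg (sub_nonneg.2 hβ.2)]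
  linarith

variable {cs : ℝ} (hcs : 0 < cs) (hCG : P.CG < 1)
include hcs hCG

theorem abs_diffCoeff_mul_le {n : ℕ} (hn : 1 ≤ n)
    (hsin : ∀ j ∈ Finset.Ico (n - depth m n) n, P.SineGE cs (w (j + 1) - w j)
      (Submodule.span ℝ ((fun i => w (i + 1) - w i) '' Set.Ico (n - depth m n) j)))
    {i : ℕ} (hi : i ∈ Finset.Ico (n - depth m n) n) :
    |diffCoeff m n (α n) i| * P.bNorm (x i - x (i - 1)) ≤
      termConst m cs P.CG * (√(1 - P.gain m w α n ^ 2) * P.bNorm (w n)) := by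
  have hi1 : 1 ≤ i := by
    have := depth_lt m hn
    have := (Finset.mem_Ico.1 hi).1
    omega
  have h1 := abs_mul_norm_le_of_sines hcs (n - depth m n) (diffCoeff m n (α n))
    (fun i => P.bMap (w (i + 1) - w i)) n (fun j hj a => by
      have := hsin j hj (∑ i ∈ Finset.Ico (n - depth m n) j, a i • (w (i + 1) - w i))
        (Submodule.sum_mem _ fun i hi => Submodule.smul_mem _ _ (Submodule.subset_span
          ⟨i, by simpa using hi, rfl⟩))
      simp only [bNorm_eq] at this
      rw [map_sub P.bMap (w (j + 1) - w j), map_sum] at this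
      simpa only [map_smul] using this) i hi
  have h2 : ∑ i ∈ Finset.Ico (n - depth m n) n,
      diffCoeff m n (α n) i • P.bMap (w (i + 1) - w i) =
      P.bMap (∑ i ∈ Finset.Ico (n - depth m n) n, diffCoeff m n (α n) i • (w (i + 1) - w i)) := by
    simp only [map_sum, map_smul]
  simp only [h2, ← bNorm_eq] at h1
  rw [h.bNorm_sum_eq hn] at h1
  have hci : 0 < cs⁻¹ := inv_pos.2 hcs
  -- The exponent is the actual depth, at most `m`, so the constant does not depend on `n`.
  have h3 : (1 + cs⁻¹) ^ (n - (n - depth m n)) ≤ (1 + cs⁻¹) ^ m := by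
    refine pow_le_pow_right₀ (by linarith) ?_
    rw [depth]; omega
  have hr : 0 ≤ √(1 - P.gain m w α n ^ 2) * P.bNorm (w n) :=
    mul_nonneg (Real.sqrt_nonneg _) (P.bNorm_nonneg _)
  have h4 : |diffCoeff m n (α n) i| * P.bNorm (w (i + 1) - w i) ≤
      cs⁻¹ * (1 + cs⁻¹) ^ m * (√(1 - P.gain m w α n ^ 2) * P.bNorm (w n)) :=
    h1.trans (by gcongr)
  have h5 := h.bNorm_step_le hCG hi1
  calc _ ≤ |diffCoeff m n (α n) i| * (P.bNorm (w (i + 1) - w i) / (1 - P.CG)) := by gcongr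
    _ = |diffCoeff m n (α n) i| * P.bNorm (w (i + 1) - w i) / (1 - P.CG) := by ring
    _ ≤ cs⁻¹ * (1 + cs⁻¹) ^ m * (√(1 - P.gain m w α n ^ 2) * P.bNorm (w n)) / (1 - P.CG) := by
      have := sub_pos.2 hCG
      gcongr
    _ = _ := by rw [termConst]; ring

/-- By the update formula the step is `β w^α` minus at most `m` terms, each bounded by the sine
condition. -/
theorem bNorm_sub_pred_le {n : ℕ} (hn : 1 ≤ n)
    (hsin : ∀ j ∈ Finset.Ico (n - depth m n) n, P.SineGE cs (w (j + 1) - w j)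
      (Submodule.span ℝ ((fun i => w (i + 1) - w i) '' Set.Ico (n - depth m n) j))) :
    P.bNorm (x n - x (n - 1)) ≤ P.bNorm (w n) *
      hTerm (2 * m * termConst m cs P.CG) (β n) (P.gain m w α n) := by
  have h1 : x n - x (n - 1) = β n • average m n (α n) w -
      ∑ i ∈ Finset.Ico (n - depth m n) n, diffCoeff m n (α n) i • (x i - x (i - 1)) := by
    conv_lhs => rw [h.update n hn, average_succ_pred]
    abel
  have h2 : P.bNorm (∑ i ∈ Finset.Ico (n - depth m n) n,
      diffCoeff m n (α n) i • (x i - x (i - 1))) ≤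
      m * (termConst m cs P.CG * (√(1 - P.gain m w α n ^ 2) * P.bNorm (w n))) := by
    have hr : 0 ≤ termConst m cs P.CG * (√(1 - P.gain m w α n ^ 2) * P.bNorm (w n)) :=
      mul_nonneg (termConst_nonneg m hcs hCG)
        (mul_nonneg (Real.sqrt_nonneg _) (P.bNorm_nonneg _))
    refine (P.bNorm_sum_le _ _).trans ((Finset.sum_le_card_nsmul _ _
      (termConst m cs P.CG * (√(1 - P.gain m w α n ^ 2) * P.bNorm (w n)))
      fun i hi => ?_).trans ?_)
    · rw [bNorm_smul]
      exact h.abs_diffCoeff_mul_le hcs hCG hn hsin hi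
    · rw [nsmul_eq_mul]
      refine mul_le_mul_of_nonneg_right ?_ hr
      rw [Nat.card_Ico, Nat.cast_le, depth]
      omega
  rw [h1]
  refine (P.bNorm_sub_le _ _).trans ?_
  rw [bNorm_smul, abs_of_pos (h.damping n hn).1, ← h.gain_mul hn, hTerm]
  -- The factor `m` would suffice here; `2 m` is what the second-order sum requires, and the surplus
  -- is discarded.
  have hr : 0 ≤ m * (termConst m cs P.CG * (√(1 - P.gain m w α n ^ 2) * P.bNorm (w n))) :=
    (P.bNorm_nonneg _).trans h2
  linarith

/-- The one-step residual bound of the Anderson accelerated Picard iteration. -/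
theorem bNorm_residual_succ_le_of_sines {k : ℕ} (hk : 1 ≤ k)
    (hsin : ∀ n ∈ Finset.Icc (k - depth m k) k, ∀ j ∈ Finset.Ico (n - depth m n) n,
      P.SineGE cs (w (j + 1) - w j)
        (Submodule.span ℝ ((fun i => w (i + 1) - w i) '' Set.Ico (n - depth m n) j)))
    {C₀ : ℝ} (hC₀ : C₀ = 2 * m * termConst m cs P.CG) {ξ η : ℕ → ℝ}
    (hξ : ∀ j, ξ j = P.gain m w α j) (hη : ∀ j, η j = hTerm C₀ (β j) (ξ j)) :
    P.bNorm (w (k + 1)) ≤ P.bNorm (w k) *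
      (ξ k * (1 - β k + P.CG * β k) + C₀ * P.CGhat * √(1 - ξ k ^ 2) / 2 *
        (P.bNorm (w k) * η k +
          2 * ∑ j ∈ Finset.Ico (k - depth m k + 1) k, ((k : ℝ) - j) * P.bNorm (w j) * η j +
          (depth m k : ℝ) * P.bNorm (w (k - depth m k)) * η (k - depth m k))) := by
  have hdk := depth_lt m hk
  have hstep {n : ℕ} (hn : n ∈ Finset.Ico (k - depth m k) (k + 1)) :
      P.bNorm (x n - x (n - 1)) ≤ P.bNorm (w n) * η n := by
    obtain ⟨hn1, hn2⟩ := Finset.mem_Ico.1 hn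
    rw [hη, hξ, hC₀]
    exact h.bNorm_sub_pred_le hcs hCG (by omega) (hsin n (Finset.mem_Icc.2 ⟨hn1, by omega⟩))
  have hpos {n : ℕ} (hn : n ∈ Finset.Ico (k - depth m k) (k + 1)) : 0 ≤ P.bNorm (w n) * η n :=
    (P.bNorm_nonneg _).trans (hstep hn)
  set S := ∑ n ∈ Finset.Ico (k - depth m k) (k + 1), P.bNorm (w n) * η n with hS
  -- Telescoping from `x i` to `x j` uses the steps `i + 1, …, j`, so `i` may lie one below the
  -- window.
  have hdist {i j : ℕ} (hij : i ≤ j) (hi : k - depth m k ≤ i + 1) (hj : j ≤ k) :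
      P.bNorm (x j - x i) ≤ S := by
    rw [← Finset.sum_Ico_sub x hij]
    refine (P.bNorm_sum_le _ _).trans ?_
    have h1 : ∑ n ∈ Finset.Ico i j, P.bNorm (x (n + 1) - x n) ≤
        ∑ n ∈ Finset.Ico i j, P.bNorm (w (n + 1)) * η (n + 1) := by
      refine Finset.sum_le_sum fun n hn => ?_
      obtain ⟨hn1, hn2⟩ := Finset.mem_Ico.1 hn
      simpa using hstep (n := n + 1) (Finset.mem_Ico.2 ⟨by omega, by omega⟩)
    refine h1.trans ?_
    rw [Finset.sum_Ico_add' (fun n => P.bNorm (w n) * η n)]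
    refine Finset.sum_le_sum_of_subset_of_nonneg ?_ fun n hn _ => hpos hn
    exact Finset.Ico_subset_Ico hi (by omega)
  set B := P.bNorm (w k) * η k +
    2 * ∑ j ∈ Finset.Ico (k - depth m k + 1) k, ((k : ℝ) - j) * P.bNorm (w j) * η j +
    (depth m k : ℝ) * P.bNorm (w (k - depth m k)) * η (k - depth m k) with hB
  have hSB (hd : 0 < depth m k) : S ≤ B := by
    have := sum_Ico_le_weighted_sum (W := fun n => P.bNorm (w n) * η n)
      (Nat.sub_lt hk hd) fun n hn => hpos hn
    rw [Nat.sub_sub_self hdk.le] at this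
    simpa only [hB, mul_assoc] using this
  set R := √(1 - ξ k ^ 2) * P.bNorm (w k) with hR
  have hR0 : 0 ≤ R := mul_nonneg (Real.sqrt_nonneg _) (P.bNorm_nonneg _)
  have ht := termConst_nonneg m hcs hCG
  have hterm {i : ℕ} (hi : i ∈ Finset.Ico (k - depth m k) k) :
      |diffCoeff m k (α k) i| * (P.bNorm (x i - x (i - 1)) *
        (P.bNorm (x (k - 1) - x (i - 1)) + P.bNorm (x i - x k))) ≤
      termConst m cs P.CG * R * (2 * B) := by
    obtain ⟨hi1, hi2⟩ := Finset.mem_Ico.1 hi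
    have h1 := h.abs_diffCoeff_mul_le hcs hCG hk
      (hsin k (Finset.mem_Icc.2 ⟨Nat.sub_le _ _, le_rfl⟩)) hi
    rw [← hξ, ← hR] at h1
    have h2 : P.bNorm (x (k - 1) - x (i - 1)) ≤ S := hdist (by omega) (by omega) (by omega)
    have h3 : P.bNorm (x i - x k) ≤ S := by
      rw [P.bNorm_eq, map_sub, norm_sub_rev, ← map_sub, ← P.bNorm_eq]
      exact hdist hi2.le (by omega) le_rfl
    have h4 := hSB (by omega)
    rw [← mul_assoc]
    refine mul_le_mul h1 (by linarith) (add_nonneg (P.bNorm_nonneg _) (P.bNorm_nonneg _))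
      (mul_nonneg ht hR0)
  have hsum : ∑ i ∈ Finset.Ico (k - depth m k) k, |diffCoeff m k (α k) i| *
      (P.bNorm (x i - x (i - 1)) * (P.bNorm (x (k - 1) - x (i - 1)) + P.bNorm (x i - x k))) ≤
      C₀ * R * B := by
    refine (Finset.sum_le_card_nsmul _ _ _ fun i hi => hterm hi).trans ?_
    rw [Nat.card_Ico, Nat.sub_sub_self hdk.le, nsmul_eq_mul, hC₀]
    -- With depth zero the sum is empty, but the bound must still be nonnegative; there `B` reduces
    -- to its first term.
    rcases (depth m k).eq_zero_or_pos with hd | hd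
    · rw [hd, Nat.cast_zero, zero_mul]
      refine mul_nonneg (by positivity) ?_
      rw [hB, hd, Nat.cast_zero, zero_mul, zero_mul, Nat.sub_zero,
        Finset.Ico_eq_empty_of_le k.le_succ, Finset.sum_empty, mul_zero, add_zero, add_zero]
      exact hpos (Finset.mem_Ico.2 ⟨Nat.sub_le _ _, k.lt_succ_self⟩)
    · have hB0 : 0 ≤ B := (Finset.sum_nonneg fun n hn => hpos hn).trans (hSB hd)
      have hdm : (depth m k : ℝ) ≤ m := by exact_mod_cast min_le_right _ _
      calc _ ≤ (m : ℝ) * (termConst m cs P.CG * R * (2 * B)) := by gcongr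
        _ = _ := by ring
  have hmain := h.bNorm_residual_succ_le hk
  have hfin := mul_le_mul_of_nonneg_left hsum (div_nonneg (CGhat_nonneg (P := P)) zero_le_two)
  rw [← hξ] at hmain
  refine (hmain.trans (add_le_add_right hfin _)).trans (le_of_eq ?_)
  rw [hR]
  ring

end IsRun

end PicardSystem

/-! ### The discrete Boussinesq problem as an abstract system -/

namespace Problem

variable {d : ℕ} {P : Problem d} {CP M : ℝ}

/-- The discretely divergence-free velocities as a subspace. -/
def VhSubmodule (P : Problem d) : Submodule ℝ (Vel P.Ω) where
  carrier := P.Vh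
  zero_mem' := by
    refine ⟨P.Xh.zero_mem, fun q _ => ?_⟩
    have : divergence (0 : Vel P.Ω) = 0 := Finset.sum_const_zero
    rw [this, inner_zero_left]
  add_mem' {v w} hv hw := by
    refine ⟨P.Xh.add_mem hv.1 hw.1, fun q hq => ?_⟩
    have : divergence (v + w) = divergence v + divergence w := Finset.sum_add_distrib
    rw [this, inner_add_left, hv.2 q hq, hw.2 q hq, add_zero]
  smul_mem' c v hv := by
    refine ⟨P.Xh.smul_mem c hv.1, fun q hq => ?_⟩
    have : c • divergence v = divergence (c • v) := Finset.smul_sum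
    rw [← this, real_inner_smul_left, hv.2 q hq, mul_zero]

theorem SmallData.Ri_mul_le (h : P.SmallData CP M) : P.Ri * CP ^ 2 ≤ P.κ := by
  have h1 : 0 < P.η := lt_min P.ν_pos P.κ_pos
  have h2 := h.2
  rw [mul_assoc, inv_mul_lt_iff₀ h1, mul_one] at h2
  exact h2.le.trans (min_le_right _ _)

theorem IsPoincareConstant.buoyancy_le (h : P.IsPoincareConstant CP)
    (θ : Temp P.Ω P.Γ) (v : Vel P.Ω) :
    P.Ri * buoyancy θ v ≤ P.Ri * CP ^ 2 * ‖gradT θ‖ * ‖gradV v‖ := by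
  rw [mul_assoc, mul_assoc]
  refine mul_le_mul_of_nonneg_left ?_ P.Ri_nonneg
  refine (le_abs_self _).trans ((abs_buoyancy_le θ v).trans ?_)
  have h1 := h.2.1 v
  have h2 := h.2.2 θ
  rw [gradNormV_eq] at h1
  rw [gradNormT_eq] at h2
  have h3 : 0 ≤ l2NormV v := Real.sqrt_nonneg _
  calc ‖fn θ‖ * l2NormV v ≤ (CP * ‖gradT θ‖) * (CP * ‖gradV v‖) :=
        mul_le_mul h2 h1 h3 (mul_nonneg h.1.le (norm_nonneg _))
    _ = _ := by ring

/-- The one-sided bound becomes two-sided by exchanging the last two arguments, which changes only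
the sign of the form. -/
theorem IsTrilinearConstant.abs_b_le (h : P.IsTrilinearConstant M) (u v w : Vel P.Ω) :
    |b u v w| ≤ M * ‖gradV u‖ * ‖gradV v‖ * ‖gradV w‖ := by
  have h1 := h.2.1 u v w
  have h2 := h.2.1 u w v
  rw [b_swap] at h2
  simp only [gradNormV_eq] at h1 h2
  exact abs_le.2 ⟨by linarith, h1⟩

theorem IsTrilinearConstant.abs_bStar_le (h : P.IsTrilinearConstant M) (u : Vel P.Ω)
    (φ ψ : Temp P.Ω P.Γ) : |bStar u φ ψ| ≤ M * ‖gradV u‖ * ‖gradT φ‖ * ‖gradT ψ‖ := by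
  have h1 := h.2.2 u φ ψ
  have h2 := h.2.2 u ψ φ
  rw [bStar_swap] at h2
  simp only [gradNormV_eq, gradNormT_eq] at h1 h2
  exact abs_le.2 ⟨by linarith, h1⟩

theorem isBoundedVel_of_mem (P : Problem d) : ∀ u ∈ P.Xh, IsBoundedVel u := P.Xh_bounded

/-- The Picard iteration of the discrete Boussinesq problem as an abstract one. -/
def toPicardSystem (hCP : P.IsPoincareConstant CP) (hM : P.IsTrilinearConstant M)
    (hsd : P.SmallData CP M) :
    PicardSystem (Vel P.Ω) (Temp P.Ω P.Γ)
      (PiLp 2 (fun _ : Fin d => PiLp 2 (fun _ : Fin d => L2 P.Ω)))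
      (PiLp 2 (fun _ : Fin d => L2 P.Ω)) where
  X := P.Xh
  SV := P.VhSubmodule
  ST := P.Wh
  gV := gradV
  gT := gradT
  bV := bL P.Xh P.isBoundedVel_of_mem
  bT := bStarL P.Xh P.isBoundedVel_of_mem
  coupling v := P.Ri • buoyancyL v
  f := P.f
  γ := P.γ
  ν := P.ν
  κ := P.κ
  M := M
  r := P.Ri * CP ^ 2
  F := dualNormV P.f
  G := dualNormT P.γ
  ν_pos := P.ν_pos
  κ_pos := P.κ_pos
  M_nonneg := hM.1.le
  r_nonneg := mul_nonneg P.Ri_nonneg (sq_nonneg _)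
  r_le := hsd.Ri_mul_le
  F_nonneg := dualNormV_nonneg _
  G_nonneg := dualNormT_nonneg _
  bV_self u v := by
    rw [bL_apply]
    linarith [b_swap u.1 v v]
  bT_self u φ := by
    rw [bStarL_apply]
    linarith [bStar_swap u.1 φ φ]
  abs_bV_le u v w := by
    rw [bL_apply]
    exact hM.abs_b_le u.1 v w
  abs_bT_le u φ ψ := hM.abs_bStar_le u.1 φ ψ
  coupling_le v θ := hCP.buoyancy_le θ v
  f_le v := (le_abs_self _).trans (abs_le_dualNormV hCP.1 hCP.2.1 _ _)
  γ_le χ := (le_abs_self _).trans (abs_le_dualNormT hCP.1 hCP.2.2 _ _)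

theorem IsPicardStep.toPicardSystem {hCP : P.IsPoincareConstant CP}
    {hM : P.IsTrilinearConstant M} {hsd : P.SmallData CP M} {u : Vel P.Ω} {y : P.State}
    (hu : u ∈ P.Xh) (h : P.IsPicardStep u y) :
    (Problem.toPicardSystem hCP hM hsd).IsStep ⟨u, hu⟩ y where
  mem_velocity := h.mem_velocity
  mem_temperature := h.mem_temperature
  energy χ hχ := by
    have := h.energy χ hχ
    rw [gradInnerT_eq] at this
    exact this
  momentum v hv := by
    have := h.momentum v hv
    rw [gradInnerV_eq] at this
    refine (congrArg (· + _) ?_).trans this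
    exact bL_apply P.Xh P.isBoundedVel_of_mem ⟨u, hu⟩ y.1 v

theorem bNorm_toPicardSystem (hCP : P.IsPoincareConstant CP) (hM : P.IsTrilinearConstant M)
    (hsd : P.SmallData CP M) (y : P.State) : (toPicardSystem hCP hM hsd).bNorm y = P.bNorm y := by
  rw [bNorm, gradNormV_eq, gradNormT_eq]
  rfl

theorem average_fst_mem {m k : ℕ} {a : ℕ → ℝ} {y : ℕ → P.State}
    (h : ∀ j ∈ Finset.Icc (k - depth m k) k, (y j).1 ∈ P.Xh) :
    (average m k a y).1 ∈ P.Xh := by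
  rw [average, Prod.fst_add, Prod.fst_sum]
  refine P.Xh.add_mem (P.Xh.smul_mem _ (h k ?_)) (P.Xh.sum_mem fun j hj => P.Xh.smul_mem _ (h j ?_))
  · exact Finset.mem_Icc.2 ⟨Nat.sub_le _ _, le_rfl⟩
  · obtain ⟨h1, h2⟩ := Finset.mem_Ico.1 hj
    exact Finset.mem_Icc.2 ⟨h1, h2.le⟩

/-- Keeps every convecting velocity in the bounded space on which the forms are trilinear. Strong
induction is needed since an iterate depends on several earlier ones. -/
theorem IsAndersonRun.mem_velocity {m : ℕ} {β : ℕ → ℝ} {x xt w : ℕ → P.State} {α : ℕ → ℕ → ℝ}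
    (h : P.IsAndersonRun m β x xt w α) (n : ℕ) : (x n).1 ∈ P.Xh := by
  induction n using Nat.strong_induction_on with
  | _ n ih =>
    rcases n.eq_zero_or_pos with rfl | hn
    · exact h.init_velocity
    have hd := depth_lt m hn
    rw [h.update n hn, Prod.fst_add, Prod.smul_fst]
    refine P.Xh.add_mem (average_fst_mem fun j hj => ?_)
      (P.Xh.smul_mem _ (average_fst_mem fun j hj => ?_))
    · obtain ⟨h1, h2⟩ := Finset.mem_Icc.1 hj
      exact ih (j - 1) (by omega)
    · obtain ⟨h1, h2⟩ := Finset.mem_Icc.1 hj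
      rw [h.residual j (by omega), Prod.fst_sub]
      exact P.Xh.sub_mem (h.picard j (by omega)).mem_velocity.1 (ih (j - 1) (by omega))

theorem IsAndersonRun.toPicardSystem {m : ℕ} {β : ℕ → ℝ} {x xt w : ℕ → P.State}
    {α : ℕ → ℕ → ℝ} (h : P.IsAndersonRun m β x xt w α) (hCP : P.IsPoincareConstant CP)
    (hM : P.IsTrilinearConstant M) (hsd : P.SmallData CP M) :
    (Problem.toPicardSystem hCP hM hsd).IsRun m β x xt w α where
  mem_velocity := h.mem_velocity
  damping k hk := by
    rcases hk.eq_or_lt with rfl | hk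
    · rw [h.damping_first]
      exact ⟨one_pos, le_rfl⟩
    · exact h.damping k hk
  picard k hk := (h.picard k hk).toPicardSystem _
  residual := h.residual
  optimal k hk a := by
    rw [bNorm_toPicardSystem, bNorm_toPicardSystem]
    exact h.optimal k hk a
  update := h.update

end Problem

end Boussinesq

end

theorem theorem3p1 :
    ∃ C : ℕ → ℝ → ℝ → ℝ,
      ∀ (d : ℕ) (_ : d = 2 ∨ d = 3) (P : Boussinesq.Problem d) (CP M : ℝ)
        (_ : P.IsPoincareConstant CP) (_ : P.IsTrilinearConstant M)
        (_ : P.SmallData CP M) (_ : P.CG CP M < 1)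
        (m : ℕ) (β : ℕ → ℝ) (x xt w : ℕ → P.State) (α : ℕ → ℕ → ℝ)
        (_ : P.IsAndersonRun m β x xt w α)
        (cs : ℝ) (_ : 0 < cs) (k : ℕ) (_ : 1 ≤ k) (_ : P.DirectionSinesGE cs m w k)
        (C₀ : ℝ) (_ : C₀ = C m cs (P.CG CP M))
        (ξ h : ℕ → ℝ) (_ : ∀ j, ξ j = P.gain m w α j)
        (_ : ∀ j, h j = Boussinesq.hTerm C₀ (β j) (ξ j))
        (mk : ℕ) (_ : mk = Boussinesq.depth m k),
        P.bNorm (w (k + 1)) ≤ P.bNorm (w k) *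
          (ξ k * (1 - β k + P.CG CP M * β k) +
            C₀ * P.CGhat CP M * √(1 - ξ k ^ 2) / 2 *
              (P.bNorm (w k) * h k +
                2 * ∑ j ∈ Finset.Ico (k - mk + 1) k, ((k : ℝ) - (j : ℝ)) * P.bNorm (w j) * h j +
                (mk : ℝ) * P.bNorm (w (k - mk)) * h (k - mk))) := by
  -- There are at most `m` quadratic terms, each with two distances between iterates: hence `2 m`
  -- times the bound for a single term.
  refine ⟨fun m cs CG => 2 * m * Boussinesq.PicardSystem.termConst m cs CG, ?_⟩
  intro d _ P CP M hCP hM hsd hCG m β x xt w α hrun cs hcs k hk hsin C₀ hC₀ ξ h hξ hh mk hmk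
  subst hmk
  have key := (hrun.toPicardSystem hCP hM hsd).bNorm_residual_succ_le_of_sines hcs hCG hk
    (fun n hn j hj g hg => by
      simp only [Boussinesq.Problem.bNorm_toPicardSystem]
      exact hsin n hn j hj g hg) hC₀ (ξ := ξ) (η := h)
    (fun j => by
      rw [hξ, Boussinesq.PicardSystem.gain, Boussinesq.Problem.bNorm_toPicardSystem,
        Boussinesq.Problem.bNorm_toPicardSystem]
      rfl) hh
  simp only [Boussinesq.Problem.bNorm_toPicardSystem] at key
  exact key
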